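/- Let $R$ be an associative ring with $1$, not necessarily commutative, and let $\mathcal{Q}$ be a class of left $R$-modules. "Module" means unital right $R$-module. Let $\mathcal{F}$ be the class of all flat modules. A module $M$ is $\mathcal{Q}$-Mittag-Leffler if for every family $(Q_i)_{i\in I}$ of modules from $\mathcal{Q}$ the canonical map $$M\otimes_R\prod_{i\in I}Q_i\to\prod_{i\in I}(M\otimes_R Q_i)$$ is injective; let $\mathcal{D}_{\mathcal{Q}}$ be the class of all flat $\mathcal{Q}$-Mittag-Leffler modules. For a cardinal $\kappa$, a module is $<\kappa$-generated if it has a generating set of cardinality $<\kappa$, and $<\kappa$-presented if it is isomorphic to $F/K$ where $F$ is free on a set of cardinality $<\kappa$ and $K$ is a $<\kappa$-generated submodule of $F$; let $\mathcal{D}_{\mathcal{Q}}^{<\kappa}$ be the class of all $<\kappa$-presented modules in $\mathcal{D}_{\mathcal{Q}}$. For a class $\mathcal{C}$ of modules put $$\mathcal{C}^\perp=\{N\mid \operatorname{Ext}^1_R(C,N)=0\text{ for all }C\in\mathcal{C}\},\qquad {}^\perp\mathcal{C}=\{M\mid \operatorname{Ext}^1_R(M,C)=0\text{ for all }C\in\mathcal{C}\}.$$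 Then: (i) For every cardinal $\kappa$, ${}^\perp((\mathcal{D}_{\mathcal{Q}}^{<\kappa})^\perp)\subseteq\mathcal{D}_{\mathcal{Q}}$. (ii) There exists a cardinal $\kappa$ such that ${}^\perp((\mathcal{D}_{\mathcal{Q}}^{<\kappa})^\perp)=\mathcal{D}_{\mathcal{Q}}$ if and only if $\mathcal{D}_{\mathcal{Q}}=\mathcal{F}$. -/

import Mathlib

universe u

open CategoryTheory Cardinal
open scoped TensorProduct MulOpposite

/-!
Rings are associative with `1`, not necessarily commutative. Left `R`-modules are the objects of
`ModuleCat R`; right `R`-modules are the objects of `ModuleCat Rᵐᵒᵖ`, with `m r` written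
`MulOpposite.op r • m`. Classes of modules are predicates on these categories.
-/

section Tensor

variable (R : Type u) [Ring R]

/-- The subgroup of `M ⊗[ℤ] N` generated by the elements `(m r) ⊗ n - m ⊗ (r n)`. -/
def balancedRelations (M : Type u) [AddCommGroup M] [Module Rᵐᵒᵖ M]
    (N : Type u) [AddCommGroup N] [Module R N] : AddSubgroup (M ⊗[ℤ] N) :=
  AddSubgroup.closure
    {x | ∃ (m : M) (r : R) (n : N), x = (MulOpposite.op r • m) ⊗ₜ[ℤ] n - m ⊗ₜ[ℤ] (r • n)}

/-- The tensor product `M ⊗_R N` of a right `R`-module `M` and a left `R`-module `N`,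
an abelian group. -/
def BalancedTensor (M : Type u) [AddCommGroup M] [Module Rᵐᵒᵖ M]
    (N : Type u) [AddCommGroup N] [Module R N] : Type u :=
  (M ⊗[ℤ] N) ⧸ balancedRelations R M N

instance BalancedTensor.instAddCommGroup (M : Type u) [AddCommGroup M] [Module Rᵐᵒᵖ M]
    (N : Type u) [AddCommGroup N] [Module R N] : AddCommGroup (BalancedTensor R M N) :=
  inferInstanceAs (AddCommGroup ((M ⊗[ℤ] N) ⧸ balancedRelations R M N))

/-- The element `m ⊗ n` of `M ⊗_R N`. -/
def BalancedTensor.tmul {M : Type u} [AddCommGroup M] [Module Rᵐᵒᵖ M]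
    {N : Type u} [AddCommGroup N] [Module R N] (m : M) (n : N) : BalancedTensor R M N :=
  QuotientAddGroup.mk' (balancedRelations R M N) (m ⊗ₜ[ℤ] n)

variable {R}

theorem balancedRelations_le_comap (M : Type u) [AddCommGroup M] [Module Rᵐᵒᵖ M]
    {N N' : Type u} [AddCommGroup N] [Module R N] [AddCommGroup N'] [Module R N']
    (f : N →ₗ[R] N') :
    balancedRelations R M N ≤ (balancedRelations R M N').comap
      (LinearMap.lTensor M f.toAddMonoidHom.toIntLinearMap).toAddMonoidHom := by
  refine (AddSubgroup.closure_le _).2 ?_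
  rintro _ ⟨m, r, n, rfl⟩
  refine AddSubgroup.subset_closure ⟨m, r, f n, ?_⟩
  simp

/-- The map `M ⊗_R f : M ⊗_R N → M ⊗_R N'`, `m ⊗ n ↦ m ⊗ f n`, induced by a homomorphism `f` of
left `R`-modules. -/
def BalancedTensor.lTensor (M : Type u) [AddCommGroup M] [Module Rᵐᵒᵖ M]
    {N N' : Type u} [AddCommGroup N] [Module R N] [AddCommGroup N'] [Module R N']
    (f : N →ₗ[R] N') : BalancedTensor R M N →+ BalancedTensor R M N' :=
  QuotientAddGroup.map (balancedRelations R M N) (balancedRelations R M N')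
    (LinearMap.lTensor M f.toAddMonoidHom.toIntLinearMap).toAddMonoidHom
    (balancedRelations_le_comap M f)

theorem BalancedTensor.lTensor_tmul (M : Type u) [AddCommGroup M] [Module Rᵐᵒᵖ M]
    {N N' : Type u} [AddCommGroup N] [Module R N] [AddCommGroup N'] [Module R N']
    (f : N →ₗ[R] N') (m : M) (n : N) :
    BalancedTensor.lTensor M f (BalancedTensor.tmul R m n) = BalancedTensor.tmul R m (f n) :=
  rfl

/-- The canonical map `ρ : M ⊗_R ∏ i, Q i → ∏ i, M ⊗_R Q i`, `m ⊗ (q i)_i ↦ (m ⊗ q i)_i`. -/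
def BalancedTensor.piMap (M : Type u) [AddCommGroup M] [Module Rᵐᵒᵖ M]
    {I : Type u} (Q : I → Type u) [∀ i, AddCommGroup (Q i)] [∀ i, Module R (Q i)] :
    BalancedTensor R M (∀ i, Q i) →+ ∀ i, BalancedTensor R M (Q i) :=
  AddMonoidHom.pi fun i => BalancedTensor.lTensor M (LinearMap.proj (R := R) (φ := Q) i)

theorem BalancedTensor.piMap_tmul (M : Type u) [AddCommGroup M] [Module Rᵐᵒᵖ M]
    {I : Type u} (Q : I → Type u) [∀ i, AddCommGroup (Q i)] [∀ i, Module R (Q i)]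
    (m : M) (q : ∀ i, Q i) :
    BalancedTensor.piMap M Q (BalancedTensor.tmul R m q) =
      fun i => BalancedTensor.tmul R m (q i) :=
  rfl

end Tensor

section Classes

variable {R : Type u} [Ring R]

/-- The class `ℱ` of all flat right `R`-modules: `M ⊗_R -` preserves injectivity. -/
def flatModules (R : Type u) [Ring R] : ObjectProperty (ModuleCat.{u} Rᵐᵒᵖ) := fun M =>
  ∀ (A B : ModuleCat.{u} R) (f : A →ₗ[R] B), Function.Injective f →
    Function.Injective (BalancedTensor.lTensor M f)

/-- The class `ℳ_𝒬` of all `𝒬`-Mittag-Leffler right `R`-modules, for a class `𝒬` of left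
`R`-modules. -/
def mittagLefflerModules (𝒬 : ObjectProperty (ModuleCat.{u} R)) :
    ObjectProperty (ModuleCat.{u} Rᵐᵒᵖ) := fun M =>
  ∀ (I : Type u) (Q : I → ModuleCat.{u} R), (∀ i, 𝒬 (Q i)) →
    Function.Injective (BalancedTensor.piMap (R := R) M fun i => Q i)

/-- The class `𝒟_𝒬` of all flat `𝒬`-Mittag-Leffler right `R`-modules. -/
def flatMittagLefflerModules (𝒬 : ObjectProperty (ModuleCat.{u} R)) :
    ObjectProperty (ModuleCat.{u} Rᵐᵒᵖ) := fun M =>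
  flatModules R M ∧ mittagLefflerModules 𝒬 M

end Classes

section General

variable {S : Type u} [Ring S]

/-- `M` is `< κ`-generated: it has a generating set of cardinality `< κ`. -/
def IsLTGenerated (S : Type u) [Ring S] (κ : Cardinal.{u})
    (M : Type u) [AddCommGroup M] [Module S M] : Prop :=
  ∃ s : Set M, #s < κ ∧ Submodule.span S s = ⊤

/-- `M` is `< κ`-presented: there is an exact sequence `0 → K → F → M → 0` with `F` free on a set
of cardinality `< κ` and `K` a `< κ`-generated module. -/
def IsLTPresented (S : Type u) [Ring S] (κ : Cardinal.{u})
    (M : Type u) [AddCommGroup M] [Module S M] : Prop :=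
  ∃ (X : Type u) (p : (X →₀ S) →ₗ[S] M),
    #X < κ ∧ Function.Surjective p ∧ IsLTGenerated S κ (LinearMap.ker p)

/-- The class `𝒜^{<κ}` of all `< κ`-presented modules in `𝒜`. -/
def ltPresentedIn (𝒜 : ObjectProperty (ModuleCat.{u} S)) (κ : Cardinal.{u}) :
    ObjectProperty (ModuleCat.{u} S) := fun M =>
  𝒜 M ∧ IsLTPresented S κ M

/-- `𝒞^⊥ = {N | Ext¹(C, N) = 0 for all C ∈ 𝒞}`. -/
def extRightPerp (𝒞 : ObjectProperty (ModuleCat.{u} S)) : ObjectProperty (ModuleCat.{u} S) :=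
  fun N => ∀ C : ModuleCat.{u} S, 𝒞 C → Subsingleton (Abelian.Ext C N 1)

/-- `^⊥𝒞 = {M | Ext¹(M, C) = 0 for all C ∈ 𝒞}`. -/
def extLeftPerp (𝒞 : ObjectProperty (ModuleCat.{u} S)) : ObjectProperty (ModuleCat.{u} S) :=
  fun M => ∀ C : ModuleCat.{u} S, 𝒞 C → Subsingleton (Abelian.Ext M C 1)

end General

/-! Both flatness and the `𝒬`-Mittag-Leffler property say that certain families of maps `M ⊗ g i`
are jointly injective (`Separates`, `IsTest`). This common form yields closure under retracts,
direct sums, extensions and filtered colimits with pure structure maps.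

Part (i): the small object argument factors a free cover of `M` as `F → A → M`. Here `A` is built
from `F` by transfinite extensions with cokernels in `𝒟_𝒬`, so `A` lies in `𝒟_𝒬`, and the lifting
property of `A → M` puts its kernel in `(𝒟_𝒬^{<κ})^⊥`. If `M` is in the double perpendicular class,
then `A → M` splits, and `M` is a retract of `A` (`extLeftPerp_extRightPerp_le`).

Part (ii), if `𝒟_𝒬 = ℱ`: every element of a flat module lies in a pure submodule of cardinality at
most `max #R ℵ₀` (`exists_small_isPure`). Such submodules and the quotients by them are flat, so
Zorn's lemma extends homomorphisms into modules of `(ℱ^{<κ})^⊥`, where `κ` is the successor of that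
bound (`flatModules_le_extLeftPerp`).

Part (ii), converse: only `𝒟_𝒬 = ^⊥𝒞` for some class `𝒞` is used. A flat module outside `𝒟_𝒬` yields
a Bass module `N`, the limit of a sequence of matrices, which is not `𝒬`-Mittag-Leffler
(`exists_bass_sequence`, `bassModule_not_mittagLeffler`). Hence `Ext¹(N, B) ≠ 0` for some `B` in
`𝒞`. Attach a copy of `N` to each branch of the tree of finite sequences in `Λ`, twisted by the
nodes of the branch. The resulting tree module is in `𝒟_𝒬` (`flatMittagLeffler_treeModule`), so its
`Ext¹` into `B` vanishes. With `#Λ = λ` chosen so that `λ ^ ℵ₀ ≥ 2 ^ λ` and `λ ≥ #B`, the `2 ^ (2 ^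
λ)` sets of branches would inject into the at most `2 ^ λ` functions from nodes to `B`,
contradicting Cantor. -/

section HomModule

variable (R : Type u) [Ring R]

/-- The abelian group of additive maps `N → A` out of a left `R`-module `N`, with its right
`R`-module structure `(φ r) n = φ (r n)`. -/
def HomModule (N : Type u) [AddCommGroup N] [Module R N] (A : Type u) [AddCommGroup A] : Type u :=
  N →+ A

variable (N : Type u) [AddCommGroup N] [Module R N] (A : Type u) [AddCommGroup A]

instance : AddCommGroup (HomModule R N A) := inferInstanceAs (AddCommGroup (N →+ A))

instance : FunLike (HomModule R N A) N A := inferInstanceAs (FunLike (N →+ A) N A)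

instance : AddMonoidHomClass (HomModule R N A) N A :=
  inferInstanceAs (AddMonoidHomClass (N →+ A) N A)

variable {R N A}

theorem HomModule.ext {φ ψ : HomModule R N A} (h : ∀ n, φ n = ψ n) : φ = ψ :=
  DFunLike.ext _ _ h

@[simp] theorem HomModule.add_apply (φ ψ : HomModule R N A) (n : N) : (φ + ψ) n = φ n + ψ n := rfl

@[simp] theorem HomModule.zero_apply (n : N) : (0 : HomModule R N A) n = 0 := rfl

instance : SMul Rᵐᵒᵖ (HomModule R N A) where
  smul r φ := AddMonoidHom.comp (show N →+ A from φ) (DistribSMul.toAddMonoidHom N r.unop)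

@[simp] theorem HomModule.smul_apply (r : Rᵐᵒᵖ) (φ : HomModule R N A) (n : N) :
    (r • φ) n = φ (r.unop • n) := rfl

instance : Module Rᵐᵒᵖ (HomModule R N A) where
  one_smul φ := HomModule.ext fun n => by simp
  mul_smul r s φ := HomModule.ext fun n => by simp [mul_smul]
  smul_zero r := HomModule.ext fun n => by simp
  smul_add r φ ψ := HomModule.ext fun n => by simp
  add_smul r s φ := HomModule.ext fun n => by simp [add_smul]
  zero_smul φ := HomModule.ext fun n => by simp

end HomModule

/-! ### Tensor products over a noncommutative ring: functoriality and right exactness. -/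

namespace BalancedTensor

variable {R : Type u} [Ring R]
variable {M M' M'' : Type u} [AddCommGroup M] [Module Rᵐᵒᵖ M] [AddCommGroup M'] [Module Rᵐᵒᵖ M']
  [AddCommGroup M''] [Module Rᵐᵒᵖ M'']
variable {N N' N'' : Type u} [AddCommGroup N] [Module R N] [AddCommGroup N'] [Module R N']
  [AddCommGroup N''] [Module R N'']
variable {A : Type u} [AddCommGroup A]

theorem tmul_add (m : M) (n n' : N) : tmul R m (n + n') = tmul R m n + tmul R m n' := by
  unfold tmul
  rw [TensorProduct.tmul_add]
  exact map_add (QuotientAddGroup.mk' (balancedRelations R M N)) _ _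

theorem add_tmul (m m' : M) (n : N) : tmul R (m + m') n = tmul R m n + tmul R m' n := by
  unfold tmul
  rw [TensorProduct.add_tmul]
  exact map_add (QuotientAddGroup.mk' (balancedRelations R M N)) _ _

theorem smul_tmul (m : M) (r : R) (n : N) :
    tmul R (MulOpposite.op r • m) n = tmul R m (r • n) := by
  rw [← sub_eq_zero]
  exact (QuotientAddGroup.eq_zero_iff _).2 (AddSubgroup.subset_closure ⟨m, r, n, rfl⟩)

/-- The bilinear map `(m, n) ↦ m ⊗ n` as a homomorphism of right `R`-modules. -/
def mk (M N : Type u) [AddCommGroup M] [Module Rᵐᵒᵖ M] [AddCommGroup N] [Module R N] :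
    M →ₗ[Rᵐᵒᵖ] HomModule R N (BalancedTensor R M N) where
  toFun m := AddMonoidHom.mk' (fun n => tmul R m n) (tmul_add m)
  map_add' m m' := HomModule.ext fun n => add_tmul m m' n
  map_smul' r m := HomModule.ext fun n => smul_tmul m r.unop n

theorem mk_apply (m : M) (n : N) : mk (R := R) M N m n = tmul R m n := rfl

@[simp] theorem tmul_zero (m : M) : tmul R m (0 : N) = 0 := map_zero (mk M N m)

@[simp] theorem zero_tmul (n : N) : tmul R (0 : M) n = 0 := by
  rw [← mk_apply, map_zero]; rfl

theorem tmul_sum {ι : Type*} (s : Finset ι) (m : M) (f : ι → N) :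
    tmul R m (∑ i ∈ s, f i) = ∑ i ∈ s, tmul R m (f i) := map_sum (mk M N m) f s

/-- Evaluation at `n`, an additive map. -/
def _root_.HomModule.eval (A : Type u) [AddCommGroup A] (n : N) : HomModule R N A →+ A where
  toFun φ := φ n
  map_zero' := rfl
  map_add' _ _ := rfl

theorem sum_tmul {ι : Type*} (s : Finset ι) (f : ι → M) (n : N) :
    tmul R (∑ i ∈ s, f i) n = ∑ i ∈ s, tmul R (f i) n :=
  map_sum ((HomModule.eval (BalancedTensor R M N) n).comp (mk (R := R) M N).toAddMonoidHom) f s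

@[elab_as_elim]
theorem induction_on {p : BalancedTensor R M N → Prop} (x : BalancedTensor R M N)
    (zero : p 0) (tmul : ∀ m n, p (tmul R m n)) (add : ∀ x y, p x → p y → p (x + y)) : p x := by
  obtain ⟨x, rfl⟩ := QuotientAddGroup.mk'_surjective (balancedRelations R M N) x
  induction x with
  | zero => rw [map_zero]; exact zero
  | tmul m n => exact tmul m n
  | add x y hx hy => rw [map_add]; exact add _ _ hx hy

theorem addHom_ext {f g : BalancedTensor R M N →+ A}
    (h : ∀ m n, f (tmul R m n) = g (tmul R m n)) : f = g := by
  ext x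
  induction x using induction_on with
  | zero => simp
  | tmul m n => exact h m n
  | add x y hx hy => rw [map_add, map_add, hx, hy]

/-- The additive map `M ⊗_R N → A` induced by a homomorphism `M → Hom(N, A)`. -/
def lift (φ : M →ₗ[Rᵐᵒᵖ] HomModule R N A) : BalancedTensor R M N →+ A :=
  QuotientAddGroup.lift (balancedRelations R M N)
    (TensorProduct.liftAddHom
      (show M →+ N →+ A from φ.toAddMonoidHom) fun r m n => by
        change φ (r • m) n = φ m (r • n)
        rw [map_zsmul, map_zsmul]; rfl) <| by
    refine (AddSubgroup.closure_le _).2 ?_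
    rintro _ ⟨m, r, n, rfl⟩
    change _ = _
    rw [map_sub, TensorProduct.liftAddHom_tmul, TensorProduct.liftAddHom_tmul, sub_eq_zero]
    change φ (MulOpposite.op r • m) n = φ m (r • n)
    rw [map_smul]; rfl

@[simp] theorem lift_tmul (φ : M →ₗ[Rᵐᵒᵖ] HomModule R N A) (m : M) (n : N) :
    lift φ (tmul R m n) = φ m n := rfl

/-- The map `f ⊗_R N : M ⊗_R N → M' ⊗_R N`. -/
def rTensor (N : Type u) [AddCommGroup N] [Module R N] (f : M →ₗ[Rᵐᵒᵖ] M') :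
    BalancedTensor R M N →+ BalancedTensor R M' N :=
  lift ((mk M' N).comp f)

@[simp] theorem rTensor_tmul (f : M →ₗ[Rᵐᵒᵖ] M') (m : M) (n : N) :
    rTensor N f (tmul R m n) = tmul R (f m) n := rfl

attribute [simp] lTensor_tmul

theorem rTensor_comp (g : M' →ₗ[Rᵐᵒᵖ] M'') (f : M →ₗ[Rᵐᵒᵖ] M') (x : BalancedTensor R M N) :
    rTensor N (g.comp f) x = rTensor N g (rTensor N f x) :=
  DFunLike.congr_fun (addHom_ext (f := rTensor N (g.comp f))
    (g := (rTensor N g).comp (rTensor N f)) fun _ _ => rfl) x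

theorem rTensor_id (x : BalancedTensor R M N) :
    rTensor N (LinearMap.id (R := Rᵐᵒᵖ) (M := M)) x = x :=
  DFunLike.congr_fun (addHom_ext (f := rTensor N (LinearMap.id (R := Rᵐᵒᵖ) (M := M)))
    (g := AddMonoidHom.id _) fun _ _ => rfl) x

theorem rTensor_zero (x : BalancedTensor R M N) : rTensor N (0 : M →ₗ[Rᵐᵒᵖ] M') x = 0 :=
  DFunLike.congr_fun (addHom_ext (f := rTensor N (0 : M →ₗ[Rᵐᵒᵖ] M'))
    (g := 0) fun _ _ => zero_tmul _) x

theorem lTensor_comp (g : N' →ₗ[R] N'') (f : N →ₗ[R] N') (x : BalancedTensor R M N) :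
    lTensor M (g.comp f) x = lTensor M g (lTensor M f x) :=
  DFunLike.congr_fun (addHom_ext (f := lTensor M (g.comp f))
    (g := (lTensor M g).comp (lTensor M f)) fun _ _ => rfl) x

theorem lTensor_zero (x : BalancedTensor R M N) : lTensor M (0 : N →ₗ[R] N') x = 0 :=
  DFunLike.congr_fun (addHom_ext (f := lTensor M (0 : N →ₗ[R] N'))
    (g := 0) fun _ _ => tmul_zero _) x

theorem rTensor_lTensor (f : M →ₗ[Rᵐᵒᵖ] M') (g : N →ₗ[R] N') (x : BalancedTensor R M N) :
    rTensor N' f (lTensor M g x) = lTensor M' g (rTensor N f x) :=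
  DFunLike.congr_fun (addHom_ext (f := (rTensor N' f).comp (lTensor M g))
    (g := (lTensor M' g).comp (rTensor N f)) fun _ _ => rfl) x

theorem exists_fin_sum (x : BalancedTensor R M N) :
    ∃ (k : ℕ) (m : Fin k → M) (n : Fin k → N), x = ∑ j, tmul R (m j) (n j) := by
  induction x using induction_on with
  | zero => exact ⟨0, 0, 0, by simp⟩
  | tmul m n => exact ⟨1, fun _ => m, fun _ => n, by simp⟩
  | add x y hx hy =>
    obtain ⟨k, m, n, rfl⟩ := hx
    obtain ⟨l, m', n', rfl⟩ := hy
    exact ⟨k + l, Fin.append m m', Fin.append n n', by simp [Fin.sum_univ_add]⟩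

theorem rTensor_surjective {f : M →ₗ[Rᵐᵒᵖ] M'} (hf : Function.Surjective f) :
    Function.Surjective (rTensor N f) := fun x => by
  induction x using induction_on with
  | zero => exact ⟨0, map_zero _⟩
  | tmul m n =>
    obtain ⟨m, rfl⟩ := hf m
    exact ⟨tmul R m n, rfl⟩
  | add x y hx hy =>
    obtain ⟨x, rfl⟩ := hx
    obtain ⟨y, rfl⟩ := hy
    exact ⟨x + y, map_add _ _ _⟩

theorem lTensor_surjective {f : N →ₗ[R] N'} (hf : Function.Surjective f) :
    Function.Surjective (lTensor M f) := fun x => by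
  induction x using induction_on with
  | zero => exact ⟨0, map_zero _⟩
  | tmul m n =>
    obtain ⟨n, rfl⟩ := hf n
    exact ⟨tmul R m n, rfl⟩
  | add x y hx hy =>
    obtain ⟨x, rfl⟩ := hx
    obtain ⟨y, rfl⟩ := hy
    exact ⟨x + y, map_add _ _ _⟩

theorem rTensor_exact {f : M →ₗ[Rᵐᵒᵖ] M'} {g : M' →ₗ[Rᵐᵒᵖ] M''} (h : Function.Exact f g)
    (hg : Function.Surjective g) : Function.Exact (rTensor N f) (rTensor N g) := by
  intro x
  constructor
  · intro hx
    let Q := BalancedTensor R M' N ⧸ (rTensor N f).range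
    -- The projection onto the cokernel of `f ⊗ N` is shown to factor through `g ⊗ N`, so it kills
    -- the kernel of `g ⊗ N`.
    let π : BalancedTensor R M' N →+ Q := QuotientAddGroup.mk' _
    let θ : M' →ₗ[Rᵐᵒᵖ] HomModule R N Q :=
      { toFun := fun m => π.comp (show N →+ BalancedTensor R M' N from mk M' N m)
        map_add' := fun m m' => HomModule.ext fun n => by
          change π (tmul R (m + m') n) = π _ + π _
          rw [add_tmul, map_add]; rfl
        map_smul' := fun r m => HomModule.ext fun n => congrArg π (smul_tmul m r.unop n) }
    have hθ : LinearMap.ker g ≤ LinearMap.ker θ := fun m hm => by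
      obtain ⟨m, rfl⟩ := (h m).1 hm
      exact HomModule.ext fun n => (QuotientAddGroup.eq_zero_iff _).2 ⟨tmul R m n, rfl⟩
    let e := LinearMap.quotKerEquivOfSurjective g hg
    let η : M'' →ₗ[Rᵐᵒᵖ] HomModule R N Q :=
      (Submodule.liftQ _ θ hθ).comp e.symm.toLinearMap
    have key : (lift η).comp (rTensor N g) = π := addHom_ext fun m n => by
      have : e.symm (g m) = Submodule.Quotient.mk m := by
        rw [LinearEquiv.symm_apply_eq]; rfl
      change Submodule.liftQ _ θ hθ (e.symm (g m)) n = _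
      rw [this]; rfl
    have : π x = 0 := by rw [← key, AddMonoidHom.comp_apply, hx, map_zero]
    exact (QuotientAddGroup.eq_zero_iff _).1 this
  · rintro ⟨y, rfl⟩
    rw [← rTensor_comp, h.linearMap_comp_eq_zero, rTensor_zero]

theorem lTensor_exact {f : N →ₗ[R] N'} {g : N' →ₗ[R] N''} (h : Function.Exact f g)
    (hg : Function.Surjective g) : Function.Exact (lTensor M f) (lTensor M g) := by
  intro x
  constructor
  · intro hx
    let Q := BalancedTensor R M N' ⧸ (lTensor M f).range
    let π : BalancedTensor R M N' →+ Q := QuotientAddGroup.mk' _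
    have hs := Function.surjInv_eq hg
    -- Independence of the chosen preimage makes the non-additive section `surjInv` induce a
    -- bilinear map.
    have hk : ∀ (m : M) (n n' : N'), g n = g n' → π (tmul R m n) = π (tmul R m n') := by
      intro m n n' e
      obtain ⟨y, hy⟩ := (h (n - n')).1 (by rw [map_sub, e, sub_self])
      have h0 : π (tmul R m (f y)) = 0 := (QuotientAddGroup.eq_zero_iff _).2 ⟨tmul R m y, rfl⟩
      rw [← sub_add_cancel n n', tmul_add, map_add, ← hy, h0]
      exact zero_add _
    let η : M →ₗ[Rᵐᵒᵖ] HomModule R N'' Q :=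
      { toFun := fun m => AddMonoidHom.mk' (fun n => π (tmul R m (Function.surjInv hg n)))
          fun n n' => by
            rw [← map_add, ← tmul_add]
            exact hk _ _ _ (by simp [hs])
        map_add' := fun m m' => HomModule.ext fun n => by
          change π _ = π _ + π _
          rw [add_tmul, map_add]
        map_smul' := fun r m => HomModule.ext fun n => by
          change π _ = π (tmul R m (Function.surjInv hg (r.unop • n)))
          rw [show r = MulOpposite.op r.unop from rfl, smul_tmul]
          exact hk _ _ _ (by simp [hs]) }
    have key : (lift η).comp (lTensor M g) = π := addHom_ext fun m n => by
      change π _ = π _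
      exact hk _ _ _ (hs _)
    have : π x = 0 := by rw [← key, AddMonoidHom.comp_apply, hx, map_zero]
    exact (QuotientAddGroup.eq_zero_iff _).1 this
  · rintro ⟨y, rfl⟩
    rw [← lTensor_comp, h.linearMap_comp_eq_zero, lTensor_zero]

end BalancedTensor

/-! ### Test families, jointly pure maps and closure properties. -/

section Separation

open BalancedTensor

variable {R : Type u} [Ring R]

/-- The maps `M ⊗ g i : M ⊗ P → M ⊗ Q i` are jointly injective. -/
def Separates (M : Type u) [AddCommGroup M] [Module Rᵐᵒᵖ M] {I : Type u} {P : ModuleCat.{u} R}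
    {Q : I → ModuleCat.{u} R} (g : ∀ i, P →ₗ[R] Q i) : Prop :=
  ∀ x : BalancedTensor R M P, (∀ i, lTensor M (g i) x = 0) → x = 0

/-- The families of homomorphisms of left `R`-modules which detect the flat `𝒬`-Mittag-Leffler
modules: single injective maps, and the projections of a product of modules from `𝒬`. -/
inductive IsTest (𝒬 : ObjectProperty (ModuleCat.{u} R)) :
    ∀ {I : Type u} {P : ModuleCat.{u} R} {Q : I → ModuleCat.{u} R}, (∀ i, P →ₗ[R] Q i) → Prop
  | of_injective {A B : ModuleCat.{u} R} (f : A →ₗ[R] B) (hf : Function.Injective f) :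
      IsTest 𝒬 (I := PUnit) (Q := fun _ => B) fun _ => f
  | of_pi {I : Type u} (Q : I → ModuleCat.{u} R) (hQ : ∀ i, 𝒬 (Q i)) :
      IsTest 𝒬 (P := ModuleCat.of R (∀ i, Q i)) (Q := Q) fun i =>
        LinearMap.proj (R := R) (φ := fun i => Q i) i

variable {𝒬 : ObjectProperty (ModuleCat.{u} R)}

/-- Since `R ⊗ g i` is `g i` up to isomorphism, this is what puts `R` itself in `𝒟_𝒬`. -/
theorem IsTest.eq_zero {I : Type u} {P : ModuleCat.{u} R} {Q : I → ModuleCat.{u} R}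
    {g : ∀ i, P →ₗ[R] Q i} (hg : IsTest 𝒬 g) (p : P) (hp : ∀ i, g i p = 0) : p = 0 := by
  cases hg with
  | of_injective f hf => exact hf (by rw [hp ⟨⟩, map_zero])
  | of_pi Q hQ => exact funext hp

theorem flatMittagLefflerModules_iff {M : ModuleCat.{u} Rᵐᵒᵖ} :
    flatMittagLefflerModules 𝒬 M ↔
      ∀ {I : Type u} {P : ModuleCat.{u} R} {Q : I → ModuleCat.{u} R} {g : ∀ i, P →ₗ[R] Q i},
        IsTest 𝒬 g → Separates M g := by
  constructor
  · rintro ⟨h, h'⟩ I P Q g hg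
    cases hg with
    | of_injective f hf =>
      exact fun x hx => h _ _ f hf (by rw [hx ⟨⟩, map_zero])
    | of_pi Q hQ =>
      exact fun x hx => h' I Q hQ (by rw [map_zero]; exact funext hx)
  · intro h
    refine ⟨fun A B f hf => ?_, fun I Q hQ => ?_⟩
    · exact (injective_iff_map_eq_zero _).2 fun x hx => h (.of_injective f hf) x fun _ => hx
    · exact (injective_iff_map_eq_zero _).2 fun x hx => h (.of_pi Q hQ) x fun i => congrFun hx i

theorem flatModules_iff {M : ModuleCat.{u} Rᵐᵒᵖ} :
    flatModules R M ↔ ∀ (A B : ModuleCat.{u} R) (f : A →ₗ[R] B), Function.Injective f →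
      ∀ x, lTensor M f x = 0 → x = 0 :=
  forall₄_congr fun _ _ _ _ => injective_iff_map_eq_zero _

/-- The maps `π j ⊗ N` are jointly injective for all left `R`-modules `N`. -/
def PureJointlyInjective {M : Type u} [AddCommGroup M] [Module Rᵐᵒᵖ M] {J : Type*} {M' : J → Type u}
    [∀ j, AddCommGroup (M' j)] [∀ j, Module Rᵐᵒᵖ (M' j)] (π : ∀ j, M →ₗ[Rᵐᵒᵖ] M' j) : Prop :=
  ∀ (N : ModuleCat.{u} R) (x : BalancedTensor R M N), (∀ j, rTensor N (π j) x = 0) → x = 0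

section

variable {M : Type u} [AddCommGroup M] [Module Rᵐᵒᵖ M] {J : Type*} {M' : J → Type u}
    [∀ j, AddCommGroup (M' j)] [∀ j, Module Rᵐᵒᵖ (M' j)] {π : ∀ j, M →ₗ[Rᵐᵒᵖ] M' j}

/-- Maps acting on different tensor factors commute, so vanishing can be tested after applying the
`π j`. Retracts, direct sums and tree modules are all handled this way. -/
theorem PureJointlyInjective.separates (hπ : PureJointlyInjective π) {I : Type u}
    {P : ModuleCat.{u} R} {Q : I → ModuleCat.{u} R} {g : ∀ i, P →ₗ[R] Q i}
    (h : ∀ j, Separates (M' j) g) : Separates M g := fun x hx =>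
  hπ _ x fun j => h j _ fun i => by rw [← rTensor_lTensor, hx, map_zero]

theorem PureJointlyInjective.flatMittagLeffler (hπ : PureJointlyInjective π)
    (h : ∀ j, flatMittagLefflerModules 𝒬 (ModuleCat.of Rᵐᵒᵖ (M' j))) :
    flatMittagLefflerModules 𝒬 (ModuleCat.of Rᵐᵒᵖ M) :=
  flatMittagLefflerModules_iff.2 fun hg =>
    hπ.separates fun j => flatMittagLefflerModules_iff.1 (h j) hg

theorem PureJointlyInjective.of_leftInverse {M₁ : Type u} [AddCommGroup M₁] [Module Rᵐᵒᵖ M₁]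
    (f : M →ₗ[Rᵐᵒᵖ] M₁) (g : M₁ →ₗ[Rᵐᵒᵖ] M) (h : g.comp f = LinearMap.id) :
    PureJointlyInjective (R := R) (fun _ : Unit => f) := fun N x hx => by
  rw [← rTensor_id x, ← h, rTensor_comp, hx ⟨⟩, map_zero]

theorem PureJointlyInjective.of_finite_decomposition (σ : ∀ j, M' j →ₗ[Rᵐᵒᵖ] M)
    (h : ∀ m, ∃ s : Finset J, ∀ t, s ⊆ t → m = ∑ j ∈ t, σ j (π j m)) :
    PureJointlyInjective π := by
  classical
  intro N x hx
  -- Asking for all larger `t` lets two tensors share one index set when they are added.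
  obtain ⟨s, hs⟩ : ∃ s : Finset J, ∀ t, s ⊆ t →
      x = ∑ j ∈ t, rTensor N (σ j) (rTensor N (π j) x) := by
    clear hx
    induction x using induction_on with
    | zero => exact ⟨∅, by simp⟩
    | tmul m n =>
      obtain ⟨s, hs⟩ := h m
      refine ⟨s, fun t ht => ?_⟩
      conv_lhs => rw [hs t ht]
      simp [sum_tmul]
    | add x y hx hy =>
      obtain ⟨s, hs⟩ := hx
      obtain ⟨s', hs'⟩ := hy
      refine ⟨s ∪ s', fun t ht => ?_⟩
      simp only [map_add, Finset.sum_add_distrib]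
      rw [← hs t (Finset.union_subset_left ht), ← hs' t (Finset.union_subset_right ht)]
  rw [hs s subset_rfl]
  simp [hx]

end

theorem exists_one_tmul {N : Type u} [AddCommGroup N] [Module R N]
    (x : BalancedTensor R Rᵐᵒᵖ N) : ∃ n, x = tmul R 1 n := by
  induction x using induction_on with
  | zero => exact ⟨0, by simp⟩
  | tmul r n =>
    refine ⟨r.unop • n, ?_⟩
    rw [← smul_tmul]; simp
  | add x y hx hy =>
    obtain ⟨n, rfl⟩ := hx
    obtain ⟨n', rfl⟩ := hy
    exact ⟨n + n', (tmul_add _ _ _).symm⟩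

/-- For a homomorphism `φ : M → R` of right modules, the map `M ⊗ N → N`, `m ⊗ n ↦ φ m • n`. -/
def BalancedTensor.eval {M : Type u} [AddCommGroup M] [Module Rᵐᵒᵖ M] (N : Type u) [AddCommGroup N]
    [Module R N] (φ : M →ₗ[Rᵐᵒᵖ] Rᵐᵒᵖ) : BalancedTensor R M N →+ N :=
  lift
    { toFun := fun m => (show N →+ N from DistribSMul.toAddMonoidHom N (φ m).unop)
      map_add' := fun m m' => HomModule.ext fun n => by
        change (φ (m + m')).unop • n = (φ m).unop • n + (φ m').unop • n
        simp [add_smul]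
      map_smul' := fun r m => HomModule.ext fun n => by
        change (φ (r • m)).unop • n = (φ m).unop • r.unop • n
        simp [mul_smul] }

@[simp] theorem BalancedTensor.eval_tmul {M : Type u} [AddCommGroup M] [Module Rᵐᵒᵖ M] {N : Type u}
    [AddCommGroup N] [Module R N] (φ : M →ₗ[Rᵐᵒᵖ] Rᵐᵒᵖ) (m : M) (n : N) :
    BalancedTensor.eval N φ (tmul R m n) = (φ m).unop • n := rfl

theorem rTensor_eq_one_tmul_eval {M : Type u} [AddCommGroup M] [Module Rᵐᵒᵖ M] {N : Type u}
    [AddCommGroup N] [Module R N] (φ : M →ₗ[Rᵐᵒᵖ] Rᵐᵒᵖ) (x : BalancedTensor R M N) :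
    rTensor N φ x = tmul R 1 (BalancedTensor.eval N φ x) := by
  induction x using induction_on with
  | zero => simp
  | tmul m n =>
    rw [eval_tmul, ← smul_tmul, rTensor_tmul]; simp
  | add x y hx hy => rw [map_add, map_add, hx, hy, tmul_add]

theorem PureJointlyInjective.of_eval {M : Type u} [AddCommGroup M] [Module Rᵐᵒᵖ M] {J : Type*}
    (φ : J → M →ₗ[Rᵐᵒᵖ] Rᵐᵒᵖ)
    (h : ∀ (N : ModuleCat.{u} R) (x : BalancedTensor R M N),
      (∀ j, BalancedTensor.eval N (φ j) x = 0) → x = 0) :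
    PureJointlyInjective (R := R) φ := fun N x hx => h N x fun j => by
  have := congrArg (BalancedTensor.eval N LinearMap.id) (hx j)
  rw [rTensor_eq_one_tmul_eval] at this
  simpa using this

theorem separates_ring {I : Type u} {P : ModuleCat.{u} R} {Q : I → ModuleCat.{u} R}
    {g : ∀ i, P →ₗ[R] Q i} (hg : ∀ p, (∀ i, g i p = 0) → p = 0) : Separates Rᵐᵒᵖ g := by
  intro x hx
  obtain ⟨p, rfl⟩ := exists_one_tmul x
  rw [hg p fun i => ?_, tmul_zero]
  have := congrArg (BalancedTensor.eval (Q i) (LinearMap.id (R := Rᵐᵒᵖ) (M := Rᵐᵒᵖ))) (hx i)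
  simpa using this

theorem flatMittagLeffler_ring :
    flatMittagLefflerModules 𝒬 (ModuleCat.of Rᵐᵒᵖ Rᵐᵒᵖ) :=
  flatMittagLefflerModules_iff.2 fun hg => separates_ring hg.eq_zero

theorem flatMittagLeffler_finsupp (X : Type u) :
    flatMittagLefflerModules 𝒬 (ModuleCat.of Rᵐᵒᵖ (X →₀ Rᵐᵒᵖ)) := by
  classical
  refine PureJointlyInjective.flatMittagLeffler
    (π := fun x : X => Finsupp.lapply (R := Rᵐᵒᵖ) (M := Rᵐᵒᵖ) x) ?_ fun _ => flatMittagLeffler_ring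
  refine .of_finite_decomposition (fun x => Finsupp.lsingle x) fun m => ⟨m.support, fun t ht => ?_⟩
  conv_lhs => rw [← Finsupp.sum_single m]
  exact Finsupp.sum_of_support_subset _ ht _ (by simp)

theorem flatMittagLeffler_directSum {ι : Type u} (C : ι → ModuleCat.{u} Rᵐᵒᵖ)
    (hC : ∀ i, flatMittagLefflerModules 𝒬 (C i)) :
    flatMittagLefflerModules 𝒬 (ModuleCat.of Rᵐᵒᵖ (Π₀ i, C i)) := by
  classical
  refine PureJointlyInjective.flatMittagLeffler
    (π := fun i : ι => DFinsupp.lapply (R := Rᵐᵒᵖ) (M := fun i => C i) i) ?_ hC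
  refine .of_finite_decomposition (fun i => DFinsupp.lsingle (R := Rᵐᵒᵖ) (M := fun i => C i) i)
    fun m => ⟨m.support, fun t ht => ?_⟩
  ext i
  by_cases hi : i ∈ t
  · rw [DFinsupp.finsetSum_apply, Finset.sum_eq_single i] <;> simp +contextual [hi]
  · rw [DFinsupp.finsetSum_apply, Finset.sum_eq_zero]
    · exact DFinsupp.notMem_support_iff.1 fun h => hi (ht h)
    · intro j hj
      simp [DFinsupp.single_apply, show j ≠ i from fun h => hi (h ▸ hj)]

theorem flatMittagLeffler_of_retract {M M' : ModuleCat.{u} Rᵐᵒᵖ} (f : M →ₗ[Rᵐᵒᵖ] M')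
    (g : M' →ₗ[Rᵐᵒᵖ] M) (h : g.comp f = LinearMap.id) (hM' : flatMittagLefflerModules 𝒬 M') :
    flatMittagLefflerModules 𝒬 M :=
  (PureJointlyInjective.of_leftInverse f g h).flatMittagLeffler fun _ => hM'

/-! ### Purity, extensions and the equational criterion for flatness. -/

/-- `f ⊗ N` is injective for all left `R`-modules `N`. -/
def IsPure {X Y : Type u} [AddCommGroup X] [Module Rᵐᵒᵖ X] [AddCommGroup Y] [Module Rᵐᵒᵖ Y]
    (f : X →ₗ[Rᵐᵒᵖ] Y) : Prop :=
  ∀ N : ModuleCat.{u} R, Function.Injective (rTensor (R := R) N f)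

section Exact

variable {X Y Z : ModuleCat.{u} Rᵐᵒᵖ} {f : X →ₗ[Rᵐᵒᵖ] Y} {q : Y →ₗ[Rᵐᵒᵖ] Z}

/-- A tensor involves finitely many coordinates of the free module, which reduces the claim to `X ⊗
R ≅ X`. -/
theorem isPure_free_aux (hf : Function.Injective f) (J : Type u)
    (x : BalancedTensor R X (J →₀ R)) (hx : rTensor (J →₀ R) f x = 0) : x = 0 := by
  classical
  obtain ⟨s, hs⟩ : ∃ s : Finset J, ∀ t, s ⊆ t →
      x = ∑ j ∈ t, lTensor X (Finsupp.lsingle (R := R) j)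
        (lTensor X (Finsupp.lapply (R := R) j) x) := by
    clear hx
    induction x using induction_on with
    | zero => exact ⟨∅, by simp⟩
    | tmul m n =>
      refine ⟨n.support, fun t ht => ?_⟩
      have : n = ∑ j ∈ t, Finsupp.single j (n j) := by
        conv_lhs => rw [← Finsupp.sum_single n]
        exact Finsupp.sum_of_support_subset _ ht _ (by simp)
      conv_lhs => rw [this]
      simp [tmul_sum]
    | add x y hx hy =>
      obtain ⟨s, hs⟩ := hx
      obtain ⟨s', hs'⟩ := hy
      refine ⟨s ∪ s', fun t ht => ?_⟩
      simp only [map_add, Finset.sum_add_distrib]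
      rw [← hs t (Finset.union_subset_left ht), ← hs' t (Finset.union_subset_right ht)]
  have hR : ∀ z : BalancedTensor R X R, rTensor R f z = 0 → z = 0 := by
    intro z hz
    obtain ⟨m, rfl⟩ : ∃ m, z = tmul R m 1 := by
      clear hz
      induction z using induction_on with
      | zero => exact ⟨0, by simp⟩
      | tmul m r => exact ⟨MulOpposite.op r • m, by rw [smul_tmul]; simp⟩
      | add x y hx hy =>
        obtain ⟨n, rfl⟩ := hx
        obtain ⟨n', rfl⟩ := hy
        exact ⟨n + n', (add_tmul _ _ _).symm⟩
    let ψ : Y →ₗ[Rᵐᵒᵖ] HomModule R R Y :=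
      { toFun := fun y => AddMonoidHom.mk' (fun r : R => MulOpposite.op r • y) fun r s => by
          simp [add_smul]
        map_add' := fun y y' => HomModule.ext fun r => smul_add (MulOpposite.op r) y y'
        map_smul' := fun s y => HomModule.ext fun r => by
          change MulOpposite.op r • s • y = MulOpposite.op (s.unop * r) • y
          rw [← mul_smul]; rfl }
    have h1 := congrArg (lift ψ) hz
    rw [rTensor_tmul, lift_tmul, map_zero] at h1
    have h2 : f m = 0 := by rw [← h1]; exact (one_smul Rᵐᵒᵖ (f m)).symm
    have h3 : m = 0 := hf (h2.trans (map_zero f).symm)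
    rw [h3, zero_tmul]
  rw [hs s subset_rfl]
  refine Finset.sum_eq_zero fun j _ => ?_
  rw [hR (lTensor X (Finsupp.lapply (R := R) j) x) (by rw [rTensor_lTensor, hx, map_zero]),
    map_zero]

/-- This is the vanishing of `Tor₁(Z, N)`, by a diagram chase on a free cover of `N`: flatness of
`Z` is used on the kernel of the cover, and injectivity of `f` on its free middle term. -/
theorem isPure_of_flat (hf : Function.Injective f) (h : Function.Exact f q)
    (hq : Function.Surjective q) (hZ : flatModules R Z) : IsPure (R := R) f := by
  refine fun N => (injective_iff_map_eq_zero _).2 fun x hx => ?_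
  let p : ModuleCat.of R (N →₀ R) →ₗ[R] N := Finsupp.linearCombination R id
  have hp : Function.Surjective p := Finsupp.linearCombination_id_surjective R N
  let k : ModuleCat.of R (LinearMap.ker p) →ₗ[R] ModuleCat.of R (N →₀ R) :=
    (LinearMap.ker p).subtype
  have hk : Function.Injective k := Subtype.val_injective
  have hkp : Function.Exact k p := LinearMap.exact_subtype_ker_map p
  obtain ⟨x, rfl⟩ := lTensor_surjective (M := X) hp x
  rw [rTensor_lTensor] at hx
  obtain ⟨y, hy⟩ := (lTensor_exact (M := Y)
    (N := ModuleCat.of R (LinearMap.ker p)) (f := k) hkp hp _).1 hx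
  have hy0 : rTensor _ q y = 0 := by
    refine flatModules_iff.1 hZ _ _ k hk _ ?_
    rw [← rTensor_lTensor, hy, ← rTensor_comp, h.linearMap_comp_eq_zero, rTensor_zero]
  obtain ⟨z, rfl⟩ := (rTensor_exact h hq _).1 hy0
  have : x = lTensor X k z := by
    refine sub_eq_zero.1 (isPure_free_aux hf N _ ?_)
    rw [map_sub, sub_eq_zero, rTensor_lTensor, hy]
  rw [this, ← lTensor_comp, hkp.linearMap_comp_eq_zero, lTensor_zero]

theorem Separates.of_exact (hf : IsPure (R := R) f) (h : Function.Exact f q)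
    (hq : Function.Surjective q) {I : Type u} {P : ModuleCat.{u} R} {Q : I → ModuleCat.{u} R}
    {g : ∀ i, P →ₗ[R] Q i} (hX : Separates X g) (hZ : Separates Z g) : Separates Y g := by
  intro y hy
  have hy0 : rTensor P q y = 0 := hZ _ fun i => by rw [← rTensor_lTensor, hy, map_zero]
  obtain ⟨x, rfl⟩ := (rTensor_exact h hq _).1 hy0
  rw [hX x fun i => hf _ (by rw [rTensor_lTensor, hy, map_zero]), map_zero]

theorem flatMittagLeffler_of_exact (hf : Function.Injective f) (h : Function.Exact f q)
    (hq : Function.Surjective q) (hX : flatMittagLefflerModules 𝒬 X)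
    (hZ : flatMittagLefflerModules 𝒬 Z) : flatMittagLefflerModules 𝒬 Y :=
  flatMittagLefflerModules_iff.2 fun hg =>
    .of_exact (isPure_of_flat hf h hq hZ.1) h hq (flatMittagLefflerModules_iff.1 hX hg)
      (flatMittagLefflerModules_iff.1 hZ hg)

end Exact

/-- If `K` is the kernel of `R ^ k → Q` given by `q`, flatness keeps `R ^ k / K → Q` injective after
tensoring. So the tensor vanishes already in `M ⊗ (R ^ k / K)` and comes from `M ⊗ K`; the `a i` are
the elements of `K` that occur. -/
theorem exists_factorization_of_sum_tmul_eq_zero {M : ModuleCat.{u} Rᵐᵒᵖ} (hM : flatModules R M)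
    {Q : ModuleCat.{u} R} {k : ℕ} (m : Fin k → M) (q : Fin k → Q)
    (h : ∑ j, tmul R (m j) (q j) = 0) :
    ∃ (l : ℕ) (e : Fin l → M) (a : Fin l → Fin k → R),
      (∀ j, m j = ∑ i, MulOpposite.op (a i j) • e i) ∧ ∀ i, ∑ j, a i j • q j = 0 := by
  classical
  let v : ULift.{u} (Fin k) → ULift.{u} (Fin k) → R := fun j => Pi.single j 1
  let f : (ULift.{u} (Fin k) → R) →ₗ[R] Q := Fintype.linearCombination R fun j => q j.down
  have hfv : ∀ j, f (v j) = q j.down := fun j => by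
    simp [f, v, Fintype.linearCombination_apply, Pi.single_apply]
  let K := LinearMap.ker f
  let g : ModuleCat.of R ((ULift.{u} (Fin k) → R) ⧸ K) →ₗ[R] Q := K.liftQ f le_rfl
  have hg : Function.Injective g := LinearMap.ker_eq_bot.1 (Submodule.ker_liftQ_eq_bot _ _ _ le_rfl)
  let x : BalancedTensor R M (ULift.{u} (Fin k) → R) := ∑ j, tmul R (m j) (v ⟨j⟩)
  have hx : lTensor M K.mkQ x = 0 := by
    refine flatModules_iff.1 hM (ModuleCat.of R ((ULift.{u} (Fin k) → R) ⧸ K)) Q g hg _ ?_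
    rw [← lTensor_comp, ← h]
    simp only [x, map_sum, lTensor_tmul]
    refine Finset.sum_congr rfl fun j _ => ?_
    rw [← hfv ⟨j⟩]; rfl
  obtain ⟨z, hz⟩ := (lTensor_exact (M := M) (LinearMap.exact_subtype_mkQ K)
    K.mkQ_surjective x).1 hx
  obtain ⟨l, e, b, rfl⟩ := exists_fin_sum z
  refine ⟨l, e, fun i j => (b i).1 ⟨j⟩, fun j => ?_, fun i => ?_⟩
  · let ψ : M →ₗ[Rᵐᵒᵖ] HomModule R (ULift.{u} (Fin k) → R) M :=
      { toFun := fun y => AddMonoidHom.mk'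
          (fun r : ULift.{u} (Fin k) → R => MulOpposite.op (r ⟨j⟩) • y) fun r s => by
          simp [add_smul]
        map_add' := fun y y' => HomModule.ext fun r => smul_add (MulOpposite.op (r ⟨j⟩)) y y'
        map_smul' := fun s y => HomModule.ext fun r => by
          change MulOpposite.op (r ⟨j⟩) • s • y = MulOpposite.op (s.unop * r ⟨j⟩) • y
          rw [← mul_smul]; rfl }
    have hψ : ∀ (y : M) (r : ULift.{u} (Fin k) → R),
        lift ψ (tmul R y r) = MulOpposite.op (r ⟨j⟩) • y :=
      fun _ _ => rfl
    have := congrArg (lift ψ) hz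
    simp only [x, map_sum, lTensor_tmul, hψ] at this
    rw [Finset.sum_eq_single j (fun i _ hi => by simp [v, Ne.symm hi]) (by simp)] at this
    simpa [v] using this.symm
  · have := (b i).2
    rw [LinearMap.mem_ker] at this
    rw [← this, Fintype.linearCombination_apply]
    exact (Equiv.ulift.sum_comp (fun j => (b i).1 ⟨j⟩ • q j)).symm

end Separation

/-! ### Vanishing of `Ext¹` as extension of homomorphisms. -/

section ExtCriterion

variable {S : Type u} [Ring S] {X Y Z : ModuleCat.{u} S} {f : X →ₗ[S] Y} {q : Y →ₗ[S] Z}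

/-- The short exact sequence of `ModuleCat S` given by exact linear maps. -/
theorem shortExact_ofHom (hf : Function.Injective f) (h : Function.Exact f q)
    (hq : Function.Surjective q) :
    (ShortComplex.mk (ModuleCat.ofHom f) (ModuleCat.ofHom q)
      (by ext x; exact h.apply_apply_eq_zero x)).ShortExact where
  exact := (ShortComplex.ShortExact.moduleCat_exact_iff_function_exact _).2 h
  mono_f := (ModuleCat.mono_iff_injective _).2 hf
  epi_g := (ModuleCat.epi_iff_surjective _).2 hq

theorem exists_extension_of_subsingleton_ext (hf : Function.Injective f) (h : Function.Exact f q)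
    (hq : Function.Surjective q) {N : ModuleCat.{u} S} (hN : Subsingleton (Abelian.Ext Z N 1))
    (φ : X →ₗ[S] N) : ∃ ψ : Y →ₗ[S] N, ∀ x, ψ (f x) = φ x := by
  obtain ⟨x₂, hx₂⟩ := Abelian.Ext.contravariant_sequence_exact₁ (shortExact_ofHom hf h hq) N
    (Abelian.Ext.mk₀ (ModuleCat.ofHom φ)) (zero_add 1 ▸ rfl) (hN.elim _ _)
  obtain ⟨ψ, rfl⟩ := Abelian.Ext.addEquiv₀.symm.surjective x₂
  refine ⟨ψ.hom, fun x => ?_⟩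
  rw [Abelian.Ext.addEquiv₀_symm_apply, Abelian.Ext.mk₀_comp_mk₀] at hx₂
  have := (Abelian.Ext.mk₀_bijective _ _).1 hx₂
  exact congrArg (fun k => k.hom x) this

theorem subsingleton_ext_of_exists_extension (hf : Function.Injective f) (h : Function.Exact f q)
    (hq : Function.Surjective q) [Module.Projective S Y] {N : ModuleCat.{u} S}
    (hN : ∀ φ : X →ₗ[S] N, ∃ ψ : Y →ₗ[S] N, ∀ x, ψ (f x) = φ x) :
    Subsingleton (Abelian.Ext Z N 1) := by
  have : Projective Y := (IsProjective.iff_projective Y).1 inferInstance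
  refine subsingleton_of_forall_eq 0 fun e => ?_
  obtain ⟨x₁, rfl⟩ := Abelian.Ext.contravariant_sequence_exact₃ (shortExact_ofHom hf h hq) N e
    (Abelian.Ext.eq_zero_of_projective _) (add_zero 1)
  obtain ⟨φ, rfl⟩ := Abelian.Ext.addEquiv₀.symm.surjective x₁
  obtain ⟨ψ, hψ⟩ := hN φ.hom
  have : φ = ModuleCat.ofHom f ≫ ModuleCat.ofHom ψ := by ext x; exact (hψ x).symm
  rw [Abelian.Ext.addEquiv₀_symm_apply, this, ← Abelian.Ext.mk₀_comp_mk₀]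
  exact (shortExact_ofHom hf h hq).extClass_comp_assoc _

end ExtCriterion

/-! ### The tensor-hom adjunction, used to make tensoring preserve colimits. -/

section TensorFunctor

open BalancedTensor

variable {R : Type u} [Ring R] (Q : ModuleCat.{u} R)

/-- The functor `- ⊗_R Q` on right `R`-modules. -/
def tensorFunctor : ModuleCat.{u} Rᵐᵒᵖ ⥤ AddCommGrpCat.{u} where
  obj M := AddCommGrpCat.of (BalancedTensor R M Q)
  map f := AddCommGrpCat.ofHom (rTensor Q f.hom)
  map_id M := by
    ext x; exact rTensor_id x
  map_comp f g := by
    ext x; exact rTensor_comp g.hom f.hom x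

/-- The functor `Hom(Q, -)` to right `R`-modules. -/
def homFunctor : AddCommGrpCat.{u} ⥤ ModuleCat.{u} Rᵐᵒᵖ where
  obj A := ModuleCat.of Rᵐᵒᵖ (HomModule R Q A)
  map {_ B} f := ModuleCat.ofHom
    { toFun := fun φ => (show HomModule R Q B from AddMonoidHom.comp f.hom φ)
      map_add' := fun φ ψ => HomModule.ext fun q => map_add f.hom _ _
      map_smul' := fun r φ => rfl }

/-- The tensor-hom adjunction. -/
def tensorHomAdjunction : tensorFunctor Q ⊣ homFunctor Q :=
  Adjunction.mkOfHomEquiv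
    { homEquiv := fun M A =>
        { toFun := fun f => ModuleCat.ofHom
            { toFun := fun m => (show HomModule R Q A from
                f.hom.comp (show Q →+ BalancedTensor R M Q from mk M Q m))
              map_add' := fun m m' => HomModule.ext fun q => by
                change f.hom (tmul R (m + m') q) = f.hom (tmul R m q) + f.hom (tmul R m' q)
                rw [add_tmul]
                exact map_add f.hom _ _
              map_smul' := fun r m => HomModule.ext fun q =>
                congrArg f.hom (smul_tmul m r.unop q) }
          invFun := fun φ => AddCommGrpCat.ofHom (lift φ.hom)
          left_inv := fun f => AddCommGrpCat.hom_ext (addHom_ext fun _ _ => rfl)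
          right_inv := fun φ => rfl }
      homEquiv_naturality_left_symm := fun f g =>
        AddCommGrpCat.hom_ext (addHom_ext fun _ _ => rfl)
      homEquiv_naturality_right := fun f g => rfl }

instance : (tensorFunctor Q).IsLeftAdjoint := (tensorHomAdjunction Q).isLeftAdjoint

end TensorFunctor

/-! ### Closure of `𝒟_𝒬` under transfinite extensions. -/

section TransfiniteExtension

open BalancedTensor Limits

variable {R : Type u} [Ring R] {𝒬 : ObjectProperty (ModuleCat.{u} R)}

/-- The injective homomorphisms of right `R`-modules with a flat `𝒬`-Mittag-Leffler cokernel. -/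
def flatMittagLefflerExtensions (𝒬 : ObjectProperty (ModuleCat.{u} R)) :
    MorphismProperty (ModuleCat.{u} Rᵐᵒᵖ) := fun _ Y f =>
  Mono f ∧ ∃ (Z : ModuleCat.{u} Rᵐᵒᵖ) (q : Y →ₗ[Rᵐᵒᵖ] Z), flatMittagLefflerModules 𝒬 Z ∧
    Function.Surjective q ∧ Function.Exact f.hom q

variable {J : Type u} [LinearOrder J] [SuccOrder J] [OrderBot J] [WellFoundedLT J]
  {X Y : ModuleCat.{u} Rᵐᵒᵖ} {f : X ⟶ Y}

/-- Tensoring preserves the colimits involved and turns each step into a monomorphism, its cokernel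
being flat. Monomorphisms of abelian groups are stable under transfinite composition. -/
theorem isPure_of_transfiniteComposition
    (h : (flatMittagLefflerExtensions 𝒬).TransfiniteCompositionOfShape J f) :
    (∀ {i j : J} (φ : i ⟶ j), IsPure (R := R) (h.F.map φ).hom) ∧
      ∀ j : J, IsPure (R := R) (h.incl.app j).hom := by
  have : ∀ Q : ModuleCat.{u} R,
      (∀ {i j : J} (φ : i ⟶ j), Mono ((tensorFunctor Q).map (h.F.map φ))) ∧
        ∀ j : J, Mono ((tensorFunctor Q).map (h.incl.app j)) := fun Q => by
    have : PreservesWellOrderContinuousOfShape J (tensorFunctor Q) := ⟨fun _ _ => inferInstance⟩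
    let W := (MorphismProperty.monomorphisms AddCommGrpCat.{u}).inverseImage (tensorFunctor Q)
    have hW : flatMittagLefflerExtensions 𝒬 ≤ W :=
      fun _ _ _ ⟨hg, _, _, hZ, hq, hgq⟩ => (AddCommGrpCat.mono_iff_injective _).2
        (isPure_of_flat ((ModuleCat.mono_iff_injective _).1 hg) hgq hq hZ.1 Q)
    exact ⟨fun φ => (h.ofLE hW).map.mem_map φ, fun j => (h.ofLE hW).map.mem_incl_app j⟩
  exact ⟨fun φ Q => (AddCommGrpCat.mono_iff_injective _).1 ((this Q).1 φ),
    fun j Q => (AddCommGrpCat.mono_iff_injective _).1 ((this Q).2 j)⟩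

/-- A tensor over the colimit comes from some stage, and purity of the structure map carries its
vanishing images back to that stage. -/
theorem flatMittagLeffler_of_isColimit {J : Type u} [SmallCategory J] [IsFiltered J]
    {F : J ⥤ ModuleCat.{u} Rᵐᵒᵖ} {c : Cocone F} (hc : IsColimit c)
    (hF : ∀ j, flatMittagLefflerModules 𝒬 (F.obj j))
    (hp : ∀ j, IsPure (R := R) (c.ι.app j).hom) : flatMittagLefflerModules 𝒬 c.pt := by
  refine flatMittagLefflerModules_iff.2 fun {I P Q g} hg x hx => ?_
  obtain ⟨j, y, rfl⟩ : ∃ j, ∃ y : BalancedTensor R (F.obj j) P,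
      rTensor P (c.ι.app j).hom y = x := by
    obtain ⟨j, y, hy⟩ := Concrete.isColimit_exists_rep (F ⋙ tensorFunctor P)
      (isColimitOfPreserves (tensorFunctor P) hc) x
    exact ⟨j, y, hy⟩
  rw [flatMittagLefflerModules_iff.1 (hF j) hg y fun i => hp j _ (by
    rw [rTensor_lTensor, map_zero]; exact hx i), map_zero]

theorem flatMittagLeffler_of_transfiniteComposition
    (h : (flatMittagLefflerExtensions 𝒬).TransfiniteCompositionOfShape J f)
    (hX : flatMittagLefflerModules 𝒬 X) : flatMittagLefflerModules 𝒬 Y := by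
  have hiso : ∀ {A B : ModuleCat.{u} Rᵐᵒᵖ}, (A ≅ B) → flatMittagLefflerModules 𝒬 A →
      flatMittagLefflerModules 𝒬 B := fun e hA =>
    flatMittagLeffler_of_retract e.inv.hom e.hom.hom (by
      rw [← ModuleCat.hom_comp, e.inv_hom_id]; rfl) hA
  obtain ⟨hmap, hincl⟩ := isPure_of_transfiniteComposition h
  have hobj : ∀ j, flatMittagLefflerModules 𝒬 (h.F.obj j) := by
    intro j
    induction j using SuccOrder.limitRecOn with
    | isMin j hj =>
      obtain rfl := hj.eq_bot
      exact hiso h.isoBot.symm hX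
    | succ j hj hj' =>
      obtain ⟨hg, Z, q, hZ, hq, hgq⟩ := h.map_mem j hj
      exact flatMittagLeffler_of_exact ((ModuleCat.mono_iff_injective _).1 hg) hgq hq hj' hZ
    | isSuccLimit j hj hj' =>
      have : Nonempty (Set.Iio j) := ⟨⟨⊥, Order.IsSuccLimit.bot_lt hj⟩⟩
      exact flatMittagLeffler_of_isColimit (h.F.isColimitOfIsWellOrderContinuous j hj)
        (fun k => hj' _ k.2) fun k => hmap _
  exact flatMittagLeffler_of_isColimit h.isColimit hobj hincl

theorem iSup_range_eq_top_of_isColimit {J : Type*} [Category* J] {S : Type u} [Ring S]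
    {F : J ⥤ ModuleCat.{u} S} {c : Cocone F} (hc : IsColimit c) :
    ⨆ j, LinearMap.range (show F.obj j →ₗ[S] c.pt from (c.ι.app j).hom) = ⊤ := by
  set p := ⨆ j, LinearMap.range (show F.obj j →ₗ[S] c.pt from (c.ι.app j).hom)
  rw [← Submodule.ker_mkQ p, LinearMap.ker_eq_top]
  have : ModuleCat.ofHom (Submodule.mkQ p) = 0 := by
    refine hc.hom_ext fun j => ?_
    ext x
    exact (Submodule.Quotient.mk_eq_zero _).2
      (Submodule.mem_iSup_of_mem j (LinearMap.mem_range_self _ x))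
  exact congrArg (fun k => k.hom) this

theorem exists_add_of_isPushout {S : Type u} [Ring S] {A B X Y : ModuleCat.{u} S} {u : A ⟶ X}
    {p : A ⟶ B} {g : X ⟶ Y} {v : B ⟶ Y} (sq : IsPushout u p g v) (y : Y) :
    ∃ x b, g.hom x + v.hom b = y := by
  let P := LinearMap.range g.hom ⊔ LinearMap.range v.hom
  have : ModuleCat.ofHom (Submodule.mkQ P) = 0 := by
    refine sq.hom_ext ?_ ?_ <;> ext x
    · exact (Submodule.Quotient.mk_eq_zero _).2
        (Submodule.mem_sup_left (LinearMap.mem_range_self _ x))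
    · exact (Submodule.Quotient.mk_eq_zero _).2
        (Submodule.mem_sup_right (LinearMap.mem_range_self _ x))
  have hy : y ∈ P := (Submodule.Quotient.mk_eq_zero _).1 (congrArg (fun k => k.hom y) this)
  obtain ⟨_, ⟨x, rfl⟩, _, ⟨b, rfl⟩, h⟩ := Submodule.mem_sup.1 hy
  exact ⟨x, b, h⟩

/-- Pushouts preserve cokernels, so the cokernel is the direct sum of the cokernels of the maps in
the coproduct. -/
theorem pushouts_coproducts_le {I : MorphismProperty (ModuleCat.{u} Rᵐᵒᵖ)}
    (hI : I ≤ flatMittagLefflerExtensions 𝒬) :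
    (MorphismProperty.coproducts.{u} I).pushouts ≤ flatMittagLefflerExtensions 𝒬 := by
  classical
  have hmono : (MorphismProperty.coproducts.{u} I).pushouts ≤
      MorphismProperty.monomorphisms (ModuleCat.{u} Rᵐᵒᵖ) := by
    rw [MorphismProperty.pushouts_le_iff, MorphismProperty.coproducts_le_iff]
    exact fun _ _ _ h => (hI _ h).1
  rintro X Y g hg
  refine ⟨hmono _ hg, ?_⟩
  obtain ⟨A, B, p, u, v, hp, sq⟩ := hg
  obtain ⟨T, hT⟩ := (MorphismProperty.coproducts_iff _ _).1 hp
  obtain ⟨X₁, X₂, c₁, c₂, h₁, h₂, φ, hφ⟩ := hT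
  have hφ' := fun j => (hI _ (hφ j)).2
  choose Z q hZ hq hex using hφ'
  let C := ModuleCat.of Rᵐᵒᵖ (Π₀ j, Z j)
  let s : ∀ j, Z j →ₗ[Rᵐᵒᵖ] C := fun j => DFinsupp.lsingle (R := Rᵐᵒᵖ) (M := fun j => Z j) j
  let c' : Cocone X₁ := ⟨c₂.pt, φ ≫ c₂.ι⟩
  let c : Cocone X₂ := ⟨C, Discrete.natTrans fun j => ModuleCat.ofHom ((s j).comp (q j))⟩
  let q₂ : c₂.pt ⟶ C := h₂.desc c
  have hq₂ : ∀ j (z : X₂.obj j), q₂.hom ((c₂.ι.app j).hom z) = s j (q j z) := fun j z =>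
    congrArg (fun k : X₂.obj j ⟶ c.pt => k.hom z) (h₂.fac c j)
  have hp₁ : ∀ j (z : X₁.obj j), (h₁.desc c').hom ((c₁.ι.app j).hom z) =
      (c₂.ι.app j).hom ((φ.app j).hom z) := fun j z =>
    congrArg (fun k : X₁.obj j ⟶ c'.pt => k.hom z) (h₁.fac c' j)
  have h0 : u ≫ 0 = h₁.desc c' ≫ q₂ := by
    refine h₁.hom_ext fun j => ModuleCat.hom_ext (LinearMap.ext fun z => ?_)
    symm
    change q₂.hom ((h₁.desc c').hom ((c₁.ι.app j).hom z)) = 0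
    rw [hp₁, hq₂, (hex j).apply_apply_eq_zero, map_zero]
  have hΨv : ∀ b, (sq.desc 0 q₂ h0).hom (v.hom b) = q₂.hom b := fun b =>
    congrArg (fun k => k.hom b) (sq.inr_desc 0 q₂ h0)
  have hΨg : ∀ x, (sq.desc 0 q₂ h0).hom (g.hom x) = 0 := fun x =>
    congrArg (fun k => k.hom x) (sq.inl_desc 0 q₂ h0)
  refine ⟨C, (sq.desc 0 q₂ h0).hom, flatMittagLeffler_directSum Z hZ, ?_, fun y => ⟨?_, ?_⟩⟩
  · rw [← LinearMap.range_eq_top, eq_top_iff]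
    rintro x -
    induction x using DFinsupp.induction with
    | h0 => exact zero_mem _
    | ha i b f _ _ hf =>
      refine add_mem ?_ hf
      obtain ⟨z, rfl⟩ := hq i b
      exact ⟨v.hom ((c₂.ι.app i).hom z), by rw [hΨv, hq₂]; rfl⟩
  · intro hy
    obtain ⟨x, b, rfl⟩ := exists_add_of_isPushout sq y
    rw [map_add, hΨg, hΨv, zero_add] at hy
    obtain ⟨f, hf, hfb⟩ := (Submodule.mem_iSup_iff_exists_finsupp _ _).1
      ((iSup_range_eq_top_of_isColimit h₂).ge (Submodule.mem_top (x := b)))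
    choose z hz using hf
    -- Comparing `j`-th coordinates in the direct sum shows that each component of `b` separately
    -- lies in a kernel.
    have hqz : ∀ j ∈ f.support, q j (z j) = 0 := fun j hj => by
      have h1 : q₂.hom b = ∑ i ∈ f.support, s i (q i (z i)) := by
        rw [← hfb, Finsupp.sum, map_sum]
        refine Finset.sum_congr rfl fun i _ => ?_
        rw [← hz i]
        exact hq₂ i (z i)
      rw [hy] at h1
      have h2 := DFunLike.congr_fun (F := Π₀ j, Z j) h1 j
      rw [DFinsupp.finsetSum_apply, Finset.sum_eq_single j] at h2
      · exact (h2.trans (DFinsupp.single_eq_same (β := fun j => Z j))).symm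
      · exact fun i _ hi => DFinsupp.single_eq_of_ne (β := fun j => Z j) hi.symm
      · exact fun h => (h hj).elim
    have hb : b ∈ LinearMap.range (h₁.desc c').hom := by
      rw [← hfb]
      refine sum_mem fun j hj => ?_
      obtain ⟨k, hk⟩ := (hex j _).1 (hqz j hj)
      refine ⟨(c₁.ι.app j).hom k, ?_⟩
      rw [hp₁, ← hz j, ← hk]
    obtain ⟨a, rfl⟩ := hb
    refine ⟨x + u.hom a, ?_⟩
    rw [map_add]
    congr 1
    exact congrArg (fun k => k.hom a) sq.w
  · rintro ⟨x, rfl⟩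
    exact hΨg x

end TransfiniteExtension

/-! ### The small object argument for a set of monomorphisms. -/

section SmallObjectArgument

open MorphismProperty

theorem hasSmallObjectArgument_of_mono {C : Type*} [Category.{u} C] [Abelian C]
    [IsGrothendieckAbelian.{u} C] {ι : Type u} {A B : ι → C} (i : ∀ j, A j ⟶ B j)
    [∀ j, Mono (i j)] : HasSmallObjectArgument.{u} (ofHoms i) := by
  have : ∀ j, ∃ T : Type u, Nonempty (Subobject (A j) ≃ T) := fun j =>
    ⟨Shrink.{u} (Subobject (A j)), ⟨equivShrink _⟩⟩
  choose T hT using this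
  -- A regular cardinal exceeding the number of subobjects of every domain: maps from the domains
  -- then commute with colimits of chains of monomorphisms of length `κ`.
  obtain ⟨κ, hκ', hκ⟩ := HasCardinalLT.exists_regular_cardinal.{u} (Σ j, T j)
  have : Fact κ.IsRegular := ⟨hκ'⟩
  have : Nonempty κ.ord.ToType := by simpa using hκ'.ne_zero
  have := WellFoundedLT.toOrderBot κ.ord.ToType
  refine ⟨κ, inferInstance, inferInstance, { preservesColimit := ?_ }⟩
  intro A' B' X Y i' hi f hf
  let hf' : (monomorphisms C).TransfiniteCompositionOfShape κ.ord.ToType f :=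
    { toTransfiniteCompositionOfShape := hf.toTransfiniteCompositionOfShape
      map_mem := fun j hj => by
        have := (hf.attachCells j hj).pushouts_coproducts
        simp only [ofHoms_homFamily] at this
        refine (?_ : _ ≤ monomorphisms C) _ this
        simp only [pushouts_le_iff, coproducts_le_iff]
        rintro _ _ _ ⟨k⟩
        exact inferInstanceAs (Mono (i k)) }
  have (j j' : κ.ord.ToType) (φ : j ⟶ j') : Mono (hf'.F.map φ) := hf'.mem_map φ
  apply IsGrothendieckAbelian.preservesColimit_coyoneda_obj_of_mono (Y := hf'.F) (κ := κ)
  obtain ⟨k⟩ := hi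
  obtain ⟨e⟩ := hT k
  exact hκ.of_injective (fun x => ⟨k, e x⟩) fun x y h => e.injective (by simpa using h)

theorem exists_cellular_factorization {C : Type*} [Category.{u} C] (I : MorphismProperty C)
    [hI : HasSmallObjectArgument.{u} I] {X Y : C} (f : X ⟶ Y) :
    ∃ (A : C) (i : X ⟶ A) (π : A ⟶ Y), i ≫ π = f ∧ I.rlp π ∧
      transfiniteCompositions.{u} (coproducts.{u} I).pushouts i := by
  obtain ⟨κ, _, _, _⟩ := hI.exists_cardinal
  exact ⟨_, _, _, SmallObject.ιObj_πObj I κ f, SmallObject.rlp_πObj I κ f,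
    transfiniteCompositionsOfShape_le_transfiniteCompositions _ _ _
      (SmallObject.transfiniteCompositionsOfShape_ιObj I κ f)⟩

end SmallObjectArgument

/-! ### The double perpendicular class lies in `𝒟_𝒬`. -/

section LeftPerp

open MorphismProperty

variable {R : Type u} [Ring R] {𝒬 : ObjectProperty (ModuleCat.{u} R)}

theorem extLeftPerp_extRightPerp_le (κ : Cardinal.{u}) :
    extLeftPerp (extRightPerp (ltPresentedIn (flatMittagLefflerModules 𝒬) κ)) ≤
      flatMittagLefflerModules 𝒬 := by
  intro M hM
  -- A set of presentations covering all `< κ`-presented modules of `𝒟_𝒬`. The number of relations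
  -- is left unbounded, which is harmless because all these quotients lie in `𝒟_𝒬`.
  let ι := {p : Σ X : Set (Quotient.out κ), Submodule Rᵐᵒᵖ (X →₀ Rᵐᵒᵖ) //
    flatMittagLefflerModules 𝒬 (ModuleCat.of Rᵐᵒᵖ ((p.1 →₀ Rᵐᵒᵖ) ⧸ p.2))}
  let k : ∀ p : ι, ModuleCat.of Rᵐᵒᵖ p.1.2 ⟶ ModuleCat.of Rᵐᵒᵖ (p.1.1 →₀ Rᵐᵒᵖ) :=
    fun p => ModuleCat.ofHom p.1.2.subtype
  have : ∀ p, Mono (k p) := fun p => (ModuleCat.mono_iff_injective _).2 Subtype.val_injective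
  have hs := hasSmallObjectArgument_of_mono k
  have hk : ofHoms k ≤ flatMittagLefflerExtensions 𝒬 := by
    rintro _ _ _ ⟨p⟩
    exact ⟨this p, _, p.1.2.mkQ, p.2, p.1.2.mkQ_surjective, LinearMap.exact_subtype_mkQ _⟩
  let p : ModuleCat.of Rᵐᵒᵖ (M →₀ Rᵐᵒᵖ) ⟶ M :=
    ModuleCat.ofHom (Finsupp.linearCombination Rᵐᵒᵖ id)
  have hp : Function.Surjective p.hom := Finsupp.linearCombination_id_surjective _ M
  obtain ⟨A, i, π, fac, hlift, hi⟩ := exists_cellular_factorization (ofHoms k) p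
  have hA : flatMittagLefflerModules 𝒬 A := by
    obtain ⟨J, _, _, _, _, ⟨h⟩⟩ := (transfiniteCompositions_iff _ _).1 hi
    exact flatMittagLeffler_of_transfiniteComposition (h.ofLE (pushouts_coproducts_le hk))
      (flatMittagLeffler_finsupp M)
  have hπ : Function.Surjective π.hom := fun m => by
    obtain ⟨x, rfl⟩ := hp m
    exact ⟨i.hom x, congrArg (fun f => f.hom x) fac⟩
  let B := ModuleCat.of Rᵐᵒᵖ (LinearMap.ker π.hom)
  have hB : extRightPerp (ltPresentedIn (flatMittagLefflerModules 𝒬) κ) B := by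
    rintro C ⟨hC, X, q, hX, hq, -⟩
    obtain ⟨e⟩ : Nonempty (X ↪ Quotient.out κ) := by
      rw [← Cardinal.le_def, Cardinal.mk_out]; exact hX.le
    let e' : X ≃ Set.range e := Equiv.ofInjective e e.injective
    let q' : (Set.range e →₀ Rᵐᵒᵖ) →ₗ[Rᵐᵒᵖ] C :=
      q.comp (Finsupp.domLCongr e'.symm).toLinearMap
    have hq' : Function.Surjective q' := hq.comp (Finsupp.domLCongr e'.symm).surjective
    let E := LinearMap.quotKerEquivOfSurjective q' hq'
    let j : ι := ⟨⟨Set.range e, LinearMap.ker q'⟩,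
      flatMittagLeffler_of_retract (M' := C) E.toLinearMap E.symm.toLinearMap (by ext; simp) hC⟩
    refine subsingleton_ext_of_exists_extension (X := ModuleCat.of Rᵐᵒᵖ (LinearMap.ker q'))
      (Y := ModuleCat.of Rᵐᵒᵖ (Set.range e →₀ Rᵐᵒᵖ)) (f := (LinearMap.ker q').subtype)
      Subtype.val_injective (LinearMap.exact_subtype_ker_map q') hq' fun φ => ?_
    -- With zero as the bottom map, a lift has image in the kernel of `π`, so it extends `φ`.
    have sq : CommSq (ModuleCat.ofHom ((LinearMap.ker π.hom).subtype.comp φ)) (k j) π 0 :=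
      ⟨by ext x; exact (φ x).2⟩
    have := (hlift _ ⟨j⟩).sq_hasLift sq
    refine ⟨LinearMap.codRestrict (LinearMap.ker π.hom) sq.lift.hom fun x => ?_, fun x => ?_⟩
    · exact congrArg (fun f => f.hom x) sq.fac_right
    · exact Subtype.ext (congrArg (fun f => f.hom x) sq.fac_left)
  obtain ⟨r, hr⟩ := exists_extension_of_subsingleton_ext (X := B) (Y := A)
    (f := (LinearMap.ker π.hom).subtype) Subtype.val_injective
    (LinearMap.exact_subtype_ker_map π.hom) hπ (hM B hB) LinearMap.id
  -- Since `r` retracts `A` onto the kernel of `π`, the complementary projection kills that kernel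
  -- and descends to a section of `π`.
  let t : A →ₗ[Rᵐᵒᵖ] A := LinearMap.id - (LinearMap.ker π.hom).subtype.comp r
  let E := LinearMap.quotKerEquivOfSurjective π.hom hπ
  have ht : LinearMap.ker π.hom ≤ LinearMap.ker t := fun x hx =>
    sub_eq_zero.2 (congrArg Subtype.val (hr ⟨x, hx⟩)).symm
  let σ : M →ₗ[Rᵐᵒᵖ] A := ((LinearMap.ker π.hom).liftQ t ht).comp E.symm.toLinearMap
  refine flatMittagLeffler_of_retract σ π.hom ?_ hA
  ext m
  obtain ⟨a, rfl⟩ := hπ m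
  have : E.symm (π.hom a) = Submodule.Quotient.mk a := by
    rw [LinearEquiv.symm_apply_eq]; rfl
  change π.hom ((LinearMap.ker π.hom).liftQ t ht (E.symm (π.hom a))) = _
  rw [this]
  change π.hom (a - (r a).1) = π.hom a
  rw [map_sub, sub_eq_self]
  exact (r a).2

end LeftPerp

/-! ### Small pure submodules and deconstructibility of flat modules. -/

section PureSubmodules

open BalancedTensor

variable {R : Type u} [Ring R]

theorem flatModules_of_isPure {X Y Z : ModuleCat.{u} Rᵐᵒᵖ} {f : X →ₗ[Rᵐᵒᵖ] Y} {q : Y →ₗ[Rᵐᵒᵖ] Z}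
    (hf : IsPure (R := R) f) (h : Function.Exact f q) (hq : Function.Surjective q)
    (hY : flatModules R Y) : flatModules R X ∧ flatModules R Z := by
  simp only [flatModules_iff] at hY ⊢
  refine ⟨fun A B g hg x hx => ?_, fun A B g hg z hz => ?_⟩
  · refine (injective_iff_map_eq_zero _).1 (hf A) _ (hY A B g hg _ ?_)
    rw [← rTensor_lTensor, hx, map_zero]
  · obtain ⟨y, rfl⟩ := rTensor_surjective hq z
    rw [← rTensor_lTensor] at hz
    obtain ⟨u, hu⟩ := (rTensor_exact h hq _).1 hz
    -- Purity tested on the cokernel of `g` moves `u` back to `X ⊗ A`; flatness of `Y` then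
    -- identifies `y` with its image.
    let C := ModuleCat.of R (B ⧸ LinearMap.range g)
    let p : B →ₗ[R] C := (LinearMap.range g).mkQ
    have hp : Function.Surjective p := Submodule.mkQ_surjective _
    have hgp : Function.Exact g p := LinearMap.exact_map_mkQ_range g
    have hpu : lTensor X p u = 0 := by
      refine (injective_iff_map_eq_zero _).1 (hf C) _ ?_
      rw [rTensor_lTensor, hu, ← lTensor_comp, hgp.linearMap_comp_eq_zero, lTensor_zero]
    obtain ⟨u, rfl⟩ := (lTensor_exact hgp hp _).1 hpu
    have : y = rTensor A f u := by
      refine sub_eq_zero.1 (hY A B g hg _ ?_)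
      rw [map_sub, sub_eq_zero, ← hu, rTensor_lTensor]
    rw [this, ← rTensor_comp, h.linearMap_comp_eq_zero, rTensor_zero]

/-- The first-order language with a function symbol for each entry of a solution of a finite system
of linear equations over `R`. -/
def solutionLanguage (R : Type u) : FirstOrder.Language.{u, 0} where
  Functions k := Σ l m : ℕ, (Fin l → Fin m → R) × (Fin k → Fin m → R) × Fin l
  Relations _ := Empty

theorem mk_sigma_nat_le {c : Cardinal.{u}} (hc : ℵ₀ ≤ c) {f : ℕ → Type u} (hf : ∀ n, #(f n) ≤ c) :
    #(Σ n, f n) ≤ c := by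
  rw [mk_sigma]
  refine (Cardinal.sum_le_sum _ (fun _ => c) hf).trans ?_
  rw [Cardinal.sum_const]
  simpa using Cardinal.mul_le_of_le hc hc le_rfl

theorem mk_fin_fun_le {c : Cardinal.{u}} (hc : ℵ₀ ≤ c) {α : Type u} (hα : #α ≤ c) (n : ℕ) :
    #(Fin n → α) ≤ c := by
  have : #(Fin n → α) = #α ^ n := by simp
  rw [this]
  exact (pow_le_pow_left' hα n).trans (Cardinal.power_nat_le hc)

theorem mk_solutionLanguage_functions_le (R : Type u) :
    #(Σ k, (solutionLanguage R).Functions k) ≤ max #R ℵ₀ := by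
  have hc : ℵ₀ ≤ max #R ℵ₀ := le_max_right _ _
  refine mk_sigma_nat_le hc fun k => mk_sigma_nat_le hc fun l => mk_sigma_nat_le hc fun m => ?_
  have h : ∀ a b : ℕ, #(Fin a → Fin b → R) ≤ max #R ℵ₀ := fun a b =>
    mk_fin_fun_le hc (mk_fin_fun_le hc (le_max_left _ _) b) a
  change #((Fin l → Fin m → R) × (Fin k → Fin m → R) × Fin l) ≤ _
  simp only [Cardinal.mk_prod]
  refine Cardinal.mul_le_of_le hc (by simpa using h l m) ?_
  simp only [Cardinal.lift_mul]
  refine Cardinal.mul_le_of_le hc (by simpa using h k m) ?_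
  simp

open Classical in
/-- The interpretation of the symbols of `solutionLanguage` in a right `R`-module by chosen
solutions. -/
@[reducible] noncomputable def solutionStructure (M : Type u) [AddCommGroup M] [Module Rᵐᵒᵖ M] :
    (solutionLanguage R).Structure M where
  funMap {_} s u :=
    if h : ∃ e : Fin s.1 → M, ∀ j, ∑ i, MulOpposite.op (s.2.2.1 i j) • e i =
        ∑ t, MulOpposite.op (s.2.2.2.1 t j) • u t
    then h.choose s.2.2.2.2 else 0
  RelMap r _ := r.elim

/-- A Löwenheim–Skolem argument: closing `e` under chosen solutions of finite linear systems gives a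
submodule in which every system with parameters there that is solvable in `M` is solvable. By the
equational criterion this gives purity, and counting symbols bounds the size. -/
theorem exists_small_isPure {M : ModuleCat.{u} Rᵐᵒᵖ} (hM : flatModules R M) (e : M) :
    ∃ U : Submodule Rᵐᵒᵖ M, e ∈ U ∧ #U ≤ max #R ℵ₀ ∧ IsPure (R := R) U.subtype := by
  let _ := solutionStructure (R := R) M
  let V := FirstOrder.Language.Substructure.closure (solutionLanguage R) {e}
  have hsol : ∀ {k l m : ℕ} (a : Fin l → Fin m → R) (b : Fin k → Fin m → R) (u : Fin k → M),
      (∀ t, u t ∈ V) → (∃ e : Fin l → M, ∀ j, ∑ i, MulOpposite.op (a i j) • e i =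
        ∑ t, MulOpposite.op (b t j) • u t) →
      ∃ e : Fin l → M, (∀ i, e i ∈ V) ∧ ∀ j, ∑ i, MulOpposite.op (a i j) • e i =
        ∑ t, MulOpposite.op (b t j) • u t := by
    classical
    intro k l m a b u hu h
    refine ⟨h.choose, fun i => ?_, h.choose_spec⟩
    have := V.fun_mem (n := k) ⟨l, m, a, b, i⟩ u hu
    change dite _ _ _ ∈ V at this
    rwa [dif_pos h] at this
  have hlin : ∀ {k : ℕ} (b : Fin k → R) (u : Fin k → M), (∀ t, u t ∈ V) →
      ∑ t, MulOpposite.op (b t) • u t ∈ V := by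
    intro k b u hu
    -- A system with one unknown of coefficient `1` has the linear combination as its only solution,
    -- so the closure contains it.
    obtain ⟨e, he, h⟩ := hsol (l := 1) (m := 1) (fun _ _ => 1) (fun t _ => b t) u hu
      ⟨fun _ => ∑ t, MulOpposite.op (b t) • u t, fun j => by simp⟩
    have := h 0
    simp only [MulOpposite.op_one, one_smul, Fin.sum_univ_one] at this
    rw [← this]
    exact he 0
  let U : Submodule Rᵐᵒᵖ M :=
    { carrier := V
      add_mem' := fun {x y} hx hy => by
        simpa using hlin (k := 2) (fun _ => 1) ![x, y] (Fin.forall_fin_two.2 ⟨hx, hy⟩)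
      zero_mem' := by simpa using hlin (k := 0) 0 0 (by simp)
      smul_mem' := fun r x hx => by
        simpa using hlin (k := 1) (fun _ => r.unop) (fun _ => x) fun _ => hx }
  refine ⟨U, FirstOrder.Language.Substructure.subset_closure (Set.mem_singleton e), ?_, ?_⟩
  · have := FirstOrder.Language.Substructure.lift_card_closure_le (L := solutionLanguage R)
      (s := ({e} : Set M))
    simp only [Cardinal.lift_id, Cardinal.mk_singleton] at this
    refine this.trans (max_le (le_max_right _ _) ?_)
    exact Cardinal.add_le_of_le (le_max_right _ _)
      ((Cardinal.one_le_aleph0).trans (le_max_right _ _)) (mk_solutionLanguage_functions_le R)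
  · refine fun N => (injective_iff_map_eq_zero _).2 fun x hx => ?_
    obtain ⟨k, u, n, rfl⟩ := exists_fin_sum x
    simp only [map_sum, rTensor_tmul] at hx
    obtain ⟨l, e, a, h, h0⟩ := exists_factorization_of_sum_tmul_eq_zero hM _ n hx
    classical
    obtain ⟨e', he', h'⟩ := hsol (k := k) a (fun t j => if t = j then 1 else 0) (fun j => (u j : M))
      (fun j => (u j).2) ⟨e, fun j => by
        rw [← h j, Finset.sum_eq_single j] <;> simp +contextual⟩
    have hu : ∀ j, u j = ∑ i, MulOpposite.op (a i j) • (⟨e' i, he' i⟩ : U) := fun j => by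
      ext
      have := h' j
      rw [Finset.sum_eq_single j (by simp +contextual) (by simp)] at this
      simpa using this.symm
    have : ∀ j, tmul R (u j) (n j) = ∑ i, tmul R (⟨e' i, he' i⟩ : U) (a i j • n j) := fun j => by
      rw [hu j, sum_tmul]
      simp only [smul_tmul]
    simp only [this]
    rw [Finset.sum_comm]
    refine Finset.sum_eq_zero fun i _ => ?_
    rw [← tmul_sum, h0, tmul_zero]

/-- All elements of `U` serve as generators and the whole kernel as relations; finitely supported
functions are counted by finite lists of pairs. -/
theorem isLTPresented_of_mk_le {S : Type u} [Ring S] {U : Type u} [AddCommGroup U] [Module S U]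
    (hU : #U ≤ max #S ℵ₀) : IsLTPresented S (Order.succ (max #S ℵ₀)) U := by
  refine ⟨U, Finsupp.linearCombination S id, Order.lt_succ_of_le hU,
    Finsupp.linearCombination_id_surjective S U, Set.univ, Order.lt_succ_of_le ?_,
    Submodule.span_univ⟩
  rw [Cardinal.mk_univ]
  refine (Cardinal.mk_subtype_le _).trans ?_
  refine (Cardinal.mk_le_of_injective (Finsupp.graph_injective U S)).trans ?_
  refine (Cardinal.mk_le_of_injective (f := Finset.toList) fun s t h => ?_).trans
    ((Cardinal.mk_list_le_max _).trans (max_le (le_max_right _ _) ?_))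
  · exact Finset.val_injective (by rw [← Finset.coe_toList, h, Finset.coe_toList])
  · rw [Cardinal.mk_prod, Cardinal.lift_id, Cardinal.lift_id]
    exact Cardinal.mul_le_of_le (le_max_right _ _) hU (le_max_left _ _)

variable {Y N : ModuleCat.{u} Rᵐᵒᵖ}

/-- The quotient by a directed union is the directed colimit of the quotients, and a tensor that
vanishes in the colimit vanishes at some stage. -/
theorem flatModules_quotient_sSup {c : Set (Submodule Rᵐᵒᵖ Y)} (hc : c.Nonempty)
    (hdir : DirectedOn (· ≤ ·) c)
    (hflat : ∀ P ∈ c, flatModules R (ModuleCat.of Rᵐᵒᵖ (Y ⧸ P))) :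
    flatModules R (ModuleCat.of Rᵐᵒᵖ (Y ⧸ sSup c)) := by
  refine flatModules_iff.2 fun A B g hg x hx => ?_
  obtain ⟨y, rfl⟩ := rTensor_surjective (Submodule.mkQ_surjective (sSup c)) x
  rw [← rTensor_lTensor] at hx
  obtain ⟨z, hz⟩ := (rTensor_exact (LinearMap.exact_subtype_mkQ _)
    (Submodule.mkQ_surjective (sSup c)) _).1 hx
  have key : ∃ P ∈ c, rTensor B P.mkQ (rTensor B (sSup c).subtype z) = 0 := by
    clear hz hx
    have hmono : ∀ {P P' : Submodule Rᵐᵒᵖ Y}, P ≤ P' → ∀ w : BalancedTensor R Y B,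
        rTensor B P.mkQ w = 0 → rTensor B P'.mkQ w = 0 := fun {P P'} h w hw => by
      rw [← Submodule.factor_comp_mk h, rTensor_comp, hw, map_zero]
    induction z using induction_on with
    | zero =>
      obtain ⟨P, hP⟩ := hc
      exact ⟨P, hP, by simp⟩
    | tmul m n =>
      obtain ⟨P, hP, hm⟩ := (Submodule.mem_sSup_of_directed hc hdir).1 m.2
      refine ⟨P, hP, ?_⟩
      rw [rTensor_tmul, rTensor_tmul, Submodule.mkQ_apply, Submodule.subtype_apply,
        (Submodule.Quotient.mk_eq_zero P).2 hm, zero_tmul]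
    | add x y hx hy =>
      obtain ⟨P, hP, hx⟩ := hx
      obtain ⟨P', hP', hy⟩ := hy
      obtain ⟨P'', hP'', h, h'⟩ := hdir P hP P' hP'
      refine ⟨P'', hP'', ?_⟩
      rw [map_add, map_add, hmono h _ hx, hmono h' _ hy, add_zero]
  obtain ⟨P, hP, hPz⟩ := key
  have hPy : rTensor A P.mkQ y = 0 := by
    refine flatModules_iff.1 (hflat P hP) A B g hg _ ?_
    rw [← rTensor_lTensor, ← hz, hPz]
  rw [← Submodule.factor_comp_mk (le_sSup hP), rTensor_comp, hPy, map_zero]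

/-- Zorn's lemma on partial extensions whose domain has a flat quotient; `flatModules_quotient_sSup`
bounds the chains. -/
theorem exists_extension_of_flat_quotient
    (hN : extRightPerp (ltPresentedIn (flatModules R) (Order.succ (max #Rᵐᵒᵖ ℵ₀))) N)
    (K : Submodule Rᵐᵒᵖ Y) (hK : flatModules R (ModuleCat.of Rᵐᵒᵖ (Y ⧸ K)))
    (φ : K →ₗ[Rᵐᵒᵖ] N) : ∃ ψ : Y →ₗ[Rᵐᵒᵖ] N, ∀ x : K, ψ x = φ x := by
  let s : Set (Y →ₗ.[Rᵐᵒᵖ] N) := {g | flatModules R (ModuleCat.of Rᵐᵒᵖ (Y ⧸ g.domain))}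
  obtain ⟨g, hφg, hg⟩ := zorn_le_nonempty₀ s (fun c hcs hc g hgc => by
    refine ⟨LinearPMap.sSup c hc.directedOn, ?_, fun f hf => LinearPMap.le_sSup _ hf⟩
    change flatModules R (ModuleCat.of Rᵐᵒᵖ (Y ⧸ (LinearPMap.sSup c hc.directedOn).domain))
    rw [LinearPMap.domain_sSup]
    refine flatModules_quotient_sSup ⟨_, g, hgc, rfl⟩
      (hc.directedOn.mono_comp LinearPMap.domain_mono.monotone) ?_
    rintro _ ⟨f, hf, rfl⟩
    exact hcs hf) ⟨K, φ⟩ hK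
  have htop : g.domain = ⊤ := by
    by_contra hne
    obtain ⟨y, -, hy⟩ := SetLike.exists_of_lt (lt_top_iff_ne_top.2 hne)
    -- A small pure `U` in the quotient is flat with flat cokernel, so `Ext¹(U, N) = 0` extends the
    -- map to the preimage `P` of `U`, which contains `y`: maximality fails.
    obtain ⟨U, heU, hU, hpure⟩ := exists_small_isPure hg.prop (Submodule.Quotient.mk y)
    let P : Submodule Rᵐᵒᵖ Y := U.comap g.domain.mkQ
    have hle : g.domain ≤ P := fun x hx => by
      change Submodule.Quotient.mk x ∈ U
      rw [(Submodule.Quotient.mk_eq_zero _).2 hx]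
      exact zero_mem _
    let q : P →ₗ[Rᵐᵒᵖ] U := g.domain.mkQ.restrict fun x hx => hx
    have hq : Function.Surjective q := fun ⟨z, hz⟩ => by
      obtain ⟨x, rfl⟩ := g.domain.mkQ_surjective z
      exact ⟨⟨x, hz⟩, rfl⟩
    have hex : Function.Exact (Submodule.inclusion hle) q := fun x => by
      rw [← Subtype.coe_inj]
      change Submodule.Quotient.mk x.1 = 0 ↔ _
      rw [Submodule.Quotient.mk_eq_zero]
      exact ⟨fun h => ⟨⟨x, h⟩, rfl⟩, fun ⟨z, hz⟩ => hz ▸ z.2⟩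
    have hex' : Function.Exact U.subtype (Submodule.factor hle) := fun x => by
      obtain ⟨x, rfl⟩ := g.domain.mkQ_surjective x
      change Submodule.Quotient.mk x = 0 ↔ _
      rw [Submodule.Quotient.mk_eq_zero]
      exact ⟨fun h => ⟨⟨_, h⟩, rfl⟩, fun ⟨z, hz⟩ => by
        change g.domain.mkQ x ∈ U
        rw [← hz]; exact z.2⟩
    obtain ⟨hUflat, hPflat⟩ := flatModules_of_isPure (X := ModuleCat.of Rᵐᵒᵖ U)
      (Y := ModuleCat.of Rᵐᵒᵖ (Y ⧸ g.domain)) (Z := ModuleCat.of Rᵐᵒᵖ (Y ⧸ P)) hpure hex'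
      (Submodule.factor_surjective hle) hg.prop
    have hUpres : IsLTPresented Rᵐᵒᵖ (Order.succ (max #Rᵐᵒᵖ ℵ₀)) U :=
      isLTPresented_of_mk_le (by rwa [Cardinal.mk_congr MulOpposite.opEquiv.symm])
    obtain ⟨ψ, hψ⟩ := exists_extension_of_subsingleton_ext (X := ModuleCat.of Rᵐᵒᵖ g.domain)
      (Y := ModuleCat.of Rᵐᵒᵖ P) (Z := ModuleCat.of Rᵐᵒᵖ U) (Submodule.inclusion_injective hle)
      hex hq (hN _ ⟨hUflat, hUpres⟩) g.toFun
    let g' : Y →ₗ.[Rᵐᵒᵖ] N := ⟨P, ψ⟩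
    have hgs : g' ∈ s := hPflat
    have hgle : g ≤ g' := ⟨hle, fun x y hxy => by
      rw [← show Submodule.inclusion hle x = y from Subtype.ext hxy]
      exact (hψ x).symm⟩
    have hge : g' ≤ g := hg.2 hgs hgle
    have hyP : y ∈ P := heU
    exact hy (hge.1 hyP)
  refine ⟨g.toFun.comp (LinearMap.codRestrict g.domain LinearMap.id fun x => htop ▸ trivial),
    fun x => ?_⟩
  exact (hφg.2 (x := x) (y := ⟨x, hφg.1 x.2⟩) rfl).symm

theorem flatModules_le_extLeftPerp :
    flatModules R ≤ extLeftPerp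
      (extRightPerp (ltPresentedIn (flatModules R) (Order.succ (max #Rᵐᵒᵖ ℵ₀)))) := by
  intro M hM N hN
  let p : (M →₀ Rᵐᵒᵖ) →ₗ[Rᵐᵒᵖ] M := Finsupp.linearCombination Rᵐᵒᵖ id
  have hp : Function.Surjective p := Finsupp.linearCombination_id_surjective _ M
  let E := LinearMap.quotKerEquivOfSurjective p hp
  refine subsingleton_ext_of_exists_extension (X := ModuleCat.of Rᵐᵒᵖ (LinearMap.ker p))
    (Y := ModuleCat.of Rᵐᵒᵖ (M →₀ Rᵐᵒᵖ)) (f := (LinearMap.ker p).subtype)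
    Subtype.val_injective (LinearMap.exact_subtype_ker_map p) hp fun φ => ?_
  refine exists_extension_of_flat_quotient (Y := ModuleCat.of Rᵐᵒᵖ (M →₀ Rᵐᵒᵖ)) hN
    (LinearMap.ker p) ?_ φ
  refine flatModules_iff.2 fun A B g hg x hx => ?_
  have h0 : rTensor A E.toLinearMap x = 0 := flatModules_iff.1 hM A B g hg _ (by
    rw [← rTensor_lTensor, hx, map_zero])
  rw [← rTensor_id x, ← E.symm_comp, rTensor_comp, h0, map_zero]

end PureSubmodules

/-! ### `Ext¹` out of a presented module as solvability of linear systems. -/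

section Presentations

variable {S : Type u} [Ring S] {ι κ : Type u} (ρ : κ → ι →₀ S)

/-- The module with generators `ι` and relations `ρ`. -/
noncomputable abbrev PresentedModule : Type u := (ι →₀ S) ⧸ Submodule.span S (Set.range ρ)

/-- The generators of a presented module. -/
noncomputable def PresentedModule.gen (i : ι) : PresentedModule ρ :=
  Submodule.Quotient.mk (Finsupp.single i 1)

variable {ρ}

/-- The homomorphism out of a presented module given by a family satisfying the relations. -/
noncomputable def PresentedModule.lift {B : Type u} [AddCommGroup B] [Module S B] (c : ι → B)
    (hc : ∀ t, Finsupp.linearCombination S c (ρ t) = 0) : PresentedModule ρ →ₗ[S] B :=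
  (Submodule.span S (Set.range ρ)).liftQ (Finsupp.linearCombination S c) <|
    Submodule.span_le.2 (by rintro _ ⟨t, rfl⟩; exact hc t)

theorem PresentedModule.lift_gen {B : Type u} [AddCommGroup B] [Module S B] (c : ι → B)
    (hc : ∀ t, Finsupp.linearCombination S c (ρ t) = 0) (i : ι) :
    PresentedModule.lift c hc (PresentedModule.gen ρ i) = c i := by
  change Finsupp.linearCombination S c (Finsupp.single i 1) = c i
  simp

theorem PresentedModule.linearCombination_gen (x : ι →₀ S) :
    Finsupp.linearCombination S (PresentedModule.gen ρ) x = Submodule.Quotient.mk x := by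
  have : Finsupp.linearCombination S (PresentedModule.gen ρ) =
      (Submodule.span S (Set.range ρ)).mkQ := by
    ext i
    simp [PresentedModule.gen]
  exact DFunLike.congr_fun this x

theorem PresentedModule.linearCombination_gen_relation (t : κ) :
    Finsupp.linearCombination S (PresentedModule.gen ρ) (ρ t) = 0 := by
  rw [PresentedModule.linearCombination_gen, Submodule.Quotient.mk_eq_zero]
  exact Submodule.subset_span ⟨t, rfl⟩

theorem PresentedModule.subsingleton_ext {B : ModuleCat.{u} S}
    (h : ∀ b : κ → B, ∃ c : ι → B, ∀ t, Finsupp.linearCombination S c (ρ t) = b t) :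
    Subsingleton (Abelian.Ext (ModuleCat.of S (PresentedModule ρ)) B 1) := by
  refine subsingleton_ext_of_exists_extension
    (X := ModuleCat.of S (Submodule.span S (Set.range ρ))) (Y := ModuleCat.of S (ι →₀ S))
    Subtype.val_injective (LinearMap.exact_subtype_mkQ _) (Submodule.mkQ_surjective _) fun φ => ?_
  obtain ⟨c, hc⟩ := h fun t => φ ⟨ρ t, Submodule.subset_span ⟨t, rfl⟩⟩
  refine ⟨Finsupp.linearCombination S c, fun ⟨x, hx⟩ => ?_⟩
  change Finsupp.linearCombination S c x = φ ⟨x, hx⟩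
  induction hx using Submodule.span_induction with
  | mem x hx =>
    obtain ⟨t, rfl⟩ := hx
    exact hc t
  | zero => exact (map_zero _).trans (map_zero φ).symm
  | add x y hx hy hx' hy' =>
    rw [map_add, hx', hy', ← map_add]; rfl
  | smul r x hx hx' =>
    rw [map_smul, hx', ← map_smul]; rfl

/-- Independence of the relations makes every right-hand side `b` a homomorphism on the relation
module, to which extension applies. -/
theorem PresentedModule.exists_of_subsingleton_ext (hρ : LinearIndependent S ρ)
    {B : ModuleCat.{u} S}
    (hB : Subsingleton (Abelian.Ext (ModuleCat.of S (PresentedModule ρ)) B 1)) (b : κ → B) :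
    ∃ c : ι → B, ∀ t, Finsupp.linearCombination S c (ρ t) = b t := by
  obtain ⟨ψ, hψ⟩ := exists_extension_of_subsingleton_ext
    (X := ModuleCat.of S (Submodule.span S (Set.range ρ))) (Y := ModuleCat.of S (ι →₀ S))
    Subtype.val_injective (LinearMap.exact_subtype_mkQ _) (Submodule.mkQ_surjective _) hB
    ((Module.Basis.span hρ).constr ℕ b)
  refine ⟨fun i => ψ (Finsupp.single i 1), fun t => ?_⟩
  have h1 : Finsupp.linearCombination S (fun i => ψ (Finsupp.single i 1)) = ψ := by
    ext i; simp
  rw [h1]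
  have h2 : ρ t = (Submodule.span S (Set.range ρ)).subtype (Module.Basis.span hρ t) := by
    simp [Module.Basis.span_apply]
  rw [h2, hψ]
  exact Module.Basis.constr_basis _ _ _ _

theorem linearIndependent_of_biorthogonal {M : Type*} [AddCommGroup M] [Module S M]
    [DecidableEq κ] {v : κ → M} (φ : κ → M →ₗ[S] S)
    (h : ∀ s t, φ s (v t) = if s = t then 1 else 0) : LinearIndependent S v := by
  rw [linearIndependent_iff]
  intro c hc
  ext s
  have : (φ s).comp (Finsupp.linearCombination S v) = Finsupp.lapply s := by
    ext t
    simp [h, Finsupp.single_apply, eq_comm]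
  have := DFunLike.congr_fun this c
  simpa [hc] using this.symm

end Presentations

/-! ### Bass modules from flat modules that are not Mittag-Leffler. -/

section Bass

open BalancedTensor

variable {R : Type u} [Ring R]

/-- Take `x ≠ 0` in the kernel of the canonical map, written as a finite sum. Some component of its
coefficients in the product is nonzero; the equational criterion at that component rewrites `x` with
coefficients vanishing there. Iterating produces the matrices, and `P n` is the factor killed at
step `n`. -/
theorem exists_bass_sequence {𝒬 : ObjectProperty (ModuleCat.{u} R)} {M : ModuleCat.{u} Rᵐᵒᵖ}
    (hM : flatModules R M) (hM' : ¬ mittagLefflerModules 𝒬 M) :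
    ∃ (k : ℕ → ℕ) (a : ∀ n, Fin (k (n + 1)) → Fin (k n) → R) (P : ℕ → ModuleCat.{u} R)
      (q : ∀ n, Fin (k n) → ∀ m, P m), (∀ n, 𝒬 (P n)) ∧
      (∀ n l m, q (n + 1) l m = ∑ j, a n l j • q n j m) ∧ (∀ n, ∃ j, q n j n ≠ 0) ∧
      ∀ n j, q (n + 1) j n = 0 := by
  simp only [mittagLefflerModules, injective_iff_map_eq_zero, not_forall] at hM'
  obtain ⟨I, Q, hQ, x, hx, hx0⟩ := hM'
  have hxi : ∀ i, lTensor M (LinearMap.proj (R := R) (φ := fun i => Q i) i) x = 0 :=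
    fun i => congrFun hx i
  let St := {s : Σ k : ℕ, (Fin k → M) × (Fin k → ∀ i, Q i) // ∑ j, tmul R (s.2.1 j) (s.2.2 j) = x}
  have step : ∀ s : St, ∃ (s' : St) (i : I) (a : Fin s'.1.1 → Fin s.1.1 → R),
      (∀ l, s'.1.2.2 l = ∑ j, a l j • s.1.2.2 j) ∧ (∃ j, s.1.2.2 j i ≠ 0) ∧
      ∀ l, s'.1.2.2 l i = 0 := by
    rintro ⟨⟨k, m, q⟩, hs⟩
    obtain ⟨i, j, hij⟩ : ∃ i j, q j i ≠ 0 := by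
      by_contra! h
      refine hx0 (hs.symm.trans (Finset.sum_eq_zero fun j _ => ?_))
      have : q j = 0 := funext fun i => h i j
      simp only [this, tmul_zero]
    have hi : ∑ j, tmul R (m j) (q j i) = 0 := by
      have := hxi i
      rw [← hs, map_sum] at this
      exact this
    obtain ⟨l, e, a, hm, ha⟩ := exists_factorization_of_sum_tmul_eq_zero hM m _ hi
    refine ⟨⟨⟨l, e, fun t => ∑ j, a t j • q j⟩, ?_⟩, i, a, fun _ => rfl, ⟨j, hij⟩, fun t => ?_⟩
    · rw [← hs]
      have : ∀ j, tmul R (m j) (q j) = ∑ t, tmul R (e t) (a t j • q j) := fun j => by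
        rw [hm j, sum_tmul]
        simp only [smul_tmul]
      simp only [this, tmul_sum]
      exact Finset.sum_comm
    · simpa using ha t
  choose next idx mat h1 h2 h3 using step
  obtain ⟨k, m, q, hmq⟩ := exists_fin_sum x
  let s : ℕ → St := fun n => n.rec ⟨⟨k, m, q⟩, hmq.symm⟩ fun _ s => next s
  refine ⟨fun n => (s n).1.1, fun n => mat (s n), fun n => Q (idx (s n)),
    fun n j m => (s n).1.2.2 j (idx (s m)), fun n => hQ _, fun n l m => ?_, fun n => h2 (s n),
    fun n j => h3 (s n) j⟩
  refine (congrFun (h1 (s n) l) _).trans ?_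
  simp

variable {k : ℕ → ℕ} (a : ∀ n, Fin (k (n + 1)) → Fin (k n) → R)

/-- The entries of the products of the matrices `a n`: `bassCoef a ⟨n, j⟩ r i` is the entry `(i, j)`
of `a (r - 1) ⋯ a n` if `n ≤ r`, and `0` otherwise. -/
def bassCoef (s : Σ n, Fin (k n)) : ∀ r, Fin (k r) → R
  | 0 => fun i => if (⟨0, i⟩ : Σ n, Fin (k n)) = s then 1 else 0
  | r + 1 => fun i => (if (⟨r + 1, i⟩ : Σ n, Fin (k n)) = s then 1 else 0) +
      ∑ t, a r i t * bassCoef s r t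

theorem bassCoef_succ (s : Σ n, Fin (k n)) (r : ℕ) (i : Fin (k (r + 1))) :
    bassCoef a s (r + 1) i = (if (⟨r + 1, i⟩ : Σ n, Fin (k n)) = s then 1 else 0) +
      ∑ t, a r i t * bassCoef a s r t :=
  rfl

theorem bassCoef_of_lt {n : ℕ} (j : Fin (k n)) {r : ℕ} (hr : r < n) (i : Fin (k r)) :
    bassCoef a ⟨n, j⟩ r i = 0 := by
  induction r with
  | zero =>
    refine if_neg fun h => ?_
    have := congrArg Sigma.fst h
    simp only at this; omega
  | succ r ih =>
    rw [bassCoef_succ, if_neg fun h => ?_, zero_add]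
    · exact Finset.sum_eq_zero fun t _ => by rw [ih (by omega), mul_zero]
    · have := congrArg Sigma.fst h
      simp only at this; omega

theorem bassCoef_self {n : ℕ} (j i : Fin (k n)) :
    bassCoef a ⟨n, j⟩ n i = if i = j then 1 else 0 := by
  cases n with
  | zero => simp [bassCoef]
  | succ n =>
    rw [bassCoef_succ, Finset.sum_eq_zero fun t _ => ?_, add_zero]
    · simp
    · rw [bassCoef_of_lt a j (Nat.lt_succ_self n), mul_zero]

/-- For fixed `(r, i)`, the coefficients satisfy every Bass relation except the one at `(r, i)`,
where the defect is `1`. Modulo eventually vanishing sequences the defect disappears; in the tree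
module it is absorbed by a node. -/
theorem bassCoef_relation {n : ℕ} (j : Fin (k n)) (r : ℕ) (i : Fin (k r)) :
    bassCoef a ⟨n, j⟩ r i - ∑ l, bassCoef a ⟨n + 1, l⟩ r i * a n l j =
      if (⟨r, i⟩ : Σ n, Fin (k n)) = ⟨n, j⟩ then 1 else 0 := by
  induction r with
  | zero =>
    rw [Finset.sum_eq_zero fun l _ => ?_, sub_zero]
    · rfl
    · rw [bassCoef_of_lt a l (Nat.succ_pos n), zero_mul]
  | succ r ih =>
    simp only [bassCoef_succ, add_mul, Finset.sum_add_distrib]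
    rw [add_sub_add_comm, Finset.sum_congr rfl fun l _ => Finset.sum_mul _ _ _, Finset.sum_comm,
      ← Finset.sum_sub_distrib]
    have : ∀ t, a r i t * bassCoef a ⟨n, j⟩ r t -
        ∑ l, a r i t * bassCoef a ⟨n + 1, l⟩ r t * a n l j =
        a r i t * if (⟨r, t⟩ : Σ n, Fin (k n)) = ⟨n, j⟩ then 1 else 0 := fun t => by
      rw [← ih, mul_sub, Finset.mul_sum]
      simp only [mul_assoc]
    simp only [this]
    rw [sub_add, sub_eq_self, sub_eq_zero]
    by_cases h : r = n
    · subst h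
      simp
    · rw [Finset.sum_eq_zero, Finset.sum_eq_zero]
      · intro t _
        rw [if_neg fun h' => h (congrArg Sigma.fst h'), mul_zero]
      · intro l _
        rw [if_neg fun h' => h (Nat.succ_injective (congrArg Sigma.fst h')), zero_mul]

/-- The generators `(n, j)` of the Bass module. -/
abbrev BassIndex (k : ℕ → ℕ) : Type u := ULift.{u} (Σ n, Fin (k n))

/-- The relations `e (n, j) = ∑ l, e (n + 1, l) (a n l j)`. -/
noncomputable def bassRelation (s : BassIndex.{u} k) : BassIndex.{u} k →₀ Rᵐᵒᵖ :=
  Finsupp.single s 1 -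
    ∑ l, Finsupp.single ⟨⟨s.down.1 + 1, l⟩⟩ (MulOpposite.op (a s.down.1 l s.down.2))

theorem linearCombination_bassRelation {B : Type*} [AddCommGroup B] [Module Rᵐᵒᵖ B]
    (c : BassIndex.{u} k → B) {n : ℕ} (j : Fin (k n)) :
    Finsupp.linearCombination Rᵐᵒᵖ c (bassRelation a ⟨⟨n, j⟩⟩) =
      c ⟨⟨n, j⟩⟩ - ∑ l, MulOpposite.op (a n l j) • c ⟨⟨n + 1, l⟩⟩ := by
  simp [bassRelation]

/-- The subgroup of eventually vanishing sequences. -/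
def eventuallyZero (X : ℕ → Type u) [∀ n, AddCommGroup (X n)] : AddSubgroup (∀ n, X n) where
  carrier := {w | ∃ n, ∀ r, n ≤ r → w r = 0}
  zero_mem' := ⟨0, fun _ _ => rfl⟩
  add_mem' := by
    rintro v w ⟨n, hn⟩ ⟨m, hm⟩
    refine ⟨max n m, fun r hr => ?_⟩
    rw [Pi.add_apply, hn r (le_of_max_le_left hr), hm r (le_of_max_le_right hr), add_zero]
  neg_mem' := by
    rintro v ⟨n, hn⟩
    exact ⟨n, fun r hr => by rw [Pi.neg_apply, hn r hr, neg_zero]⟩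

/-- The value of `bassTensorMap` at a generator of the Bass module. -/
noncomputable def bassTensorGen (X : Type u) [AddCommGroup X] [Module R X] (s : BassIndex.{u} k) :
    HomModule R X ((∀ r, Fin (k r) → X) ⧸ eventuallyZero fun r => Fin (k r) → X) :=
  (AddMonoidHom.comp (QuotientAddGroup.mk' _)
    (AddMonoidHom.mk' (fun x r i => bassCoef a s.down r i • x) fun x y => by ext; simp) : X →+ _)

theorem bassTensorGen_apply (X : Type u) [AddCommGroup X] [Module R X] (s : BassIndex.{u} k)
    (x : X) : bassTensorGen a X s x =
      QuotientAddGroup.mk' (eventuallyZero fun r => Fin (k r) → X)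
        fun r i => bassCoef a s.down r i • x :=
  rfl

/-- The canonical map from the tensor product of the Bass module and `X` to the sequences with
entries in the groups `X ^ (k n)`, modulo the eventually vanishing ones. -/
noncomputable def bassTensorMap (X : Type u) [AddCommGroup X] [Module R X] :
    BalancedTensor R (PresentedModule (bassRelation.{u} a)) X →+
      (∀ r, Fin (k r) → X) ⧸ eventuallyZero fun r => Fin (k r) → X :=
  BalancedTensor.lift (PresentedModule.lift (bassTensorGen a X) (by
      rintro ⟨n, j⟩
      rw [linearCombination_bassRelation, sub_eq_zero]
      refine HomModule.ext fun x => ?_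
      have : ∀ (s : Finset (Fin (k (n + 1)))) (f : Fin (k (n + 1)) → HomModule R X
        ((∀ r, Fin (k r) → X) ⧸ eventuallyZero fun r => Fin (k r) → X)),
          (∑ l ∈ s, f l) x = ∑ l ∈ s, f l x := fun s f => map_sum (HomModule.eval _ x) f s
      rw [this]
      simp only [HomModule.smul_apply, bassTensorGen_apply]
      rw [← map_sum, ← sub_eq_zero, ← map_sub]
      refine (QuotientAddGroup.eq_zero_iff _).2 ⟨n + 1, fun r hr => funext fun i => ?_⟩
      have h := congrArg (· • x) (bassCoef_relation a j r i)
      rw [if_neg fun h => by have := congrArg Sigma.fst h; simp only at this; omega] at h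
      simpa [sub_smul, mul_smul, Finset.sum_smul] using h))

/-- The tensor `x` has the same shape at every level. Level `m + 1` shows that its component `m`
vanishes, so `x` is in the kernel of the canonical map. Yet `bassTensorMap` sends it to the class of
`q`, whose term at `r` is nonzero in component `r`. -/
theorem bassModule_not_mittagLeffler {𝒬 : ObjectProperty (ModuleCat.{u} R)}
    {P : ℕ → ModuleCat.{u} R} {q : ∀ n, Fin (k n) → ∀ m, P m} (hP : ∀ n, 𝒬 (P n))
    (hq : ∀ n l m, q (n + 1) l m = ∑ j, a n l j • q n j m) (hq' : ∀ n, ∃ j, q n j n ≠ 0)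
    (hq0 : ∀ n j, q (n + 1) j n = 0) :
    ¬ mittagLefflerModules 𝒬 (ModuleCat.of Rᵐᵒᵖ (PresentedModule (bassRelation.{u} a))) := by
  intro h
  let N := PresentedModule (bassRelation.{u} a)
  let X := ∀ m : ULift.{u} ℕ, P m.down
  let g : (Σ n, Fin (k n)) → N := fun s => PresentedModule.gen _ ⟨s⟩
  let q₁ : ∀ n, Fin (k n) → X := fun n j m => q n j m.down
  have hg : ∀ n (j : Fin (k n)), g ⟨n, j⟩ = ∑ l, MulOpposite.op (a n l j) • g ⟨n + 1, l⟩ :=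
    fun n j => by
      have := PresentedModule.linearCombination_gen_relation (ρ := bassRelation.{u} a) ⟨⟨n, j⟩⟩
      rw [linearCombination_bassRelation, sub_eq_zero] at this
      exact this
  have hq₁ : ∀ n l, q₁ (n + 1) l = ∑ j, a n l j • q₁ n j := fun n l => funext fun m => by
    rw [Finset.sum_apply]
    exact hq n l m.down
  let x : BalancedTensor R N X := ∑ j, tmul R (g ⟨0, j⟩) (q₁ 0 j)
  have hx : ∀ n, x = ∑ j, tmul R (g ⟨n, j⟩) (q₁ n j) := by
    intro n
    induction n with
    | zero => rfl
    | succ n ih =>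
      have h1 : ∀ j, tmul R (g ⟨n, j⟩) (q₁ n j) =
          ∑ l, tmul R (g ⟨n + 1, l⟩) (a n l j • q₁ n j) := fun j => by
        rw [hg, sum_tmul]
        simp only [smul_tmul]
      rw [ih, Finset.sum_congr rfl fun j _ => h1 j, Finset.sum_comm]
      simp only [hq₁, tmul_sum]
  have hx0 : x = 0 := by
    refine (injective_iff_map_eq_zero _).1 (h (ULift.{u} ℕ) (fun m => P m.down) fun m => hP _) x ?_
    refine funext fun m => ?_
    rw [hx (m.down + 1), map_sum, Finset.sum_apply]
    refine Finset.sum_eq_zero fun j _ => ?_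
    change tmul R (g ⟨m.down + 1, j⟩) (q (m.down + 1) j m.down) = 0
    rw [hq0, tmul_zero]
  have hx1 : bassTensorMap a X x =
      QuotientAddGroup.mk' (eventuallyZero fun r => Fin (k r) → X) fun r i => q₁ r i := by
    have h1 : ∀ j (y : X), bassTensorMap a X (tmul R (g ⟨0, j⟩) y) =
        QuotientAddGroup.mk' (eventuallyZero fun r => Fin (k r) → X)
          fun r i => bassCoef a ⟨0, j⟩ r i • y := fun j y => by
      rw [bassTensorMap, lift_tmul, PresentedModule.lift_gen]
      rfl
    simp only [x, map_sum, h1]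
    rw [← map_sum]
    congr 1
    funext r
    induction r with
    | zero =>
      funext i
      simp [bassCoef_self]
    | succ r ih =>
      funext i
      have ih' : ∀ i, ∑ j, bassCoef a ⟨0, j⟩ r i • q₁ 0 j = q₁ r i := fun i => by
        simpa only [Finset.sum_apply] using congrFun ih i
      simp only [Finset.sum_apply]
      rw [hq₁]
      simp only [← ih', Finset.smul_sum]
      rw [Finset.sum_comm]
      refine Finset.sum_congr rfl fun j _ => ?_
      rw [bassCoef_succ, if_neg fun h => by have := congrArg Sigma.fst h; simp at this]
      simp [Finset.sum_smul, mul_smul]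
  rw [hx0, map_zero, eq_comm] at hx1
  obtain ⟨n, hn⟩ := (QuotientAddGroup.eq_zero_iff _).1 hx1
  obtain ⟨j, hj⟩ := hq' n
  exact hj (congrFun (congrFun (hn n le_rfl) j) ⟨n⟩)

end Bass

/-! ### The tree module and its membership in `𝒟_𝒬`. -/

section Tree

open BalancedTensor

variable {R : Type u} [Ring R] {k : ℕ → ℕ} (a : ∀ n, Fin (k (n + 1)) → Fin (k n) → R)
  (Λ : Type u)

/-- Finite sequences in `Λ`, decorated with an index below `k` of the length. -/
abbrev TreeNode (k : ℕ → ℕ) (Λ : Type u) : Type u := Σ m, (Fin m → Λ) × Fin (k m)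

/-- A generator of the Bass module for every branch `ℕ → Λ` of the tree. -/
abbrev TreeBranch (k : ℕ → ℕ) (Λ : Type u) : Type u := (ℕ → Λ) × BassIndex.{u} k

variable {Λ}

/-- The nodes on the branch `ν`. -/
def branchNode (ν : ℕ → Λ) (m : ℕ) (i : Fin (k m)) : TreeNode k Λ := ⟨m, (fun t => ν t, i)⟩

theorem branchNode_eq_iff (ν ν' : ℕ → Λ) {m n : ℕ} (i : Fin (k m)) (j : Fin (k n)) :
    branchNode ν n j = branchNode ν' m i ↔
      (fun t : Fin m => ν t) = (fun t : Fin m => ν' t) ∧ (⟨m, i⟩ : Σ n, Fin (k n)) = ⟨n, j⟩ := by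
  constructor
  · intro h
    obtain rfl : n = m := congrArg Sigma.fst h
    have := eq_of_heq (Sigma.mk.inj h).2
    exact ⟨congrArg Prod.fst this, by rw [show j = i from congrArg Prod.snd this]⟩
  · rintro ⟨h, h'⟩
    obtain rfl : m = n := congrArg Sigma.fst h'
    obtain rfl : i = j := eq_of_heq (Sigma.mk.inj h').2
    exact congrArg (fun w => (⟨m, (w, i)⟩ : TreeNode k Λ)) h

/-- The relations `e (ν, n, j) = ∑ l, e (ν, n + 1, l) (a n l j) + e (ν|n, j)`. -/
noncomputable def treeRelation (t : TreeBranch k Λ) : (TreeNode k Λ ⊕ TreeBranch k Λ) →₀ Rᵐᵒᵖ :=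
  Finsupp.single (Sum.inr t) 1 -
    ∑ l, Finsupp.single (Sum.inr (t.1, ⟨⟨t.2.down.1 + 1, l⟩⟩))
      (MulOpposite.op (a t.2.down.1 l t.2.down.2)) -
    Finsupp.single (Sum.inl (branchNode t.1 t.2.down.1 t.2.down.2)) 1

theorem linearCombination_treeRelation {B : Type*} [AddCommGroup B] [Module Rᵐᵒᵖ B]
    (c : TreeNode k Λ ⊕ TreeBranch k Λ → B) (ν : ℕ → Λ) {n : ℕ} (j : Fin (k n)) :
    Finsupp.linearCombination Rᵐᵒᵖ c (treeRelation a (ν, ⟨⟨n, j⟩⟩)) =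
      c (Sum.inr (ν, ⟨⟨n, j⟩⟩)) -
        ∑ l, MulOpposite.op (a n l j) • c (Sum.inr (ν, ⟨⟨n + 1, l⟩⟩)) -
        c (Sum.inl (branchNode ν n j)) := by
  simp [treeRelation]

theorem op_bassCoef_relation {n : ℕ} (j : Fin (k n)) (r : ℕ) (i : Fin (k r)) :
    MulOpposite.op (bassCoef a ⟨n, j⟩ r i) -
        ∑ l, MulOpposite.op (a n l j) • MulOpposite.op (bassCoef a ⟨n + 1, l⟩ r i) =
      if (⟨r, i⟩ : Σ n, Fin (k n)) = ⟨n, j⟩ then 1 else 0 := by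
  have := congrArg MulOpposite.opAddEquiv (bassCoef_relation a j r i)
  rw [map_sub, map_sum] at this
  refine this.trans ?_
  split_ifs <;> rfl

open Classical in
theorem linearIndependent_treeRelation :
    LinearIndependent Rᵐᵒᵖ (treeRelation (Λ := Λ) a) := by
  -- The dual functionals vanish on nodes and use the Bass coefficients on a single branch; the
  -- defect in `bassCoef_relation` gives the Kronecker delta.
  refine linearIndependent_of_biorthogonal (fun s => Finsupp.linearCombination Rᵐᵒᵖ
    (Sum.elim 0 fun t => if t.1 = s.1 then
      MulOpposite.op (bassCoef a t.2.down s.2.down.1 s.2.down.2) else 0)) ?_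
  rintro ⟨ν', ⟨⟨r, i⟩⟩⟩ ⟨ν, ⟨⟨n, j⟩⟩⟩
  rw [linearCombination_treeRelation]
  simp only [Sum.elim_inr, Sum.elim_inl, Pi.zero_apply, sub_zero]
  by_cases h : ν = ν'
  · subst h
    simp only [if_true, op_bassCoef_relation, Prod.mk.injEq, true_and, ULift.up_inj]
  · simp [h, Ne.symm h]

/-- The tree module: nodes of the tree and, for each branch, a copy of the Bass module twisted by
the nodes on the branch. -/
noncomputable abbrev TreeModule (Λ : Type u) : Type u := PresentedModule (treeRelation (Λ := Λ) a)

open Classical in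
/-- The coordinate of the tree module at a node. -/
noncomputable def treeCoord (τ : TreeNode k Λ) : TreeModule a Λ →ₗ[Rᵐᵒᵖ] Rᵐᵒᵖ :=
  PresentedModule.lift
    (Sum.elim (fun x => if x = τ then 1 else 0) fun t =>
      if (fun i : Fin τ.1 => t.1 i) = τ.2.1 then
        MulOpposite.op (bassCoef a t.2.down τ.1 τ.2.2) else 0) <| by
    rintro ⟨ν, ⟨⟨n, j⟩⟩⟩
    rw [linearCombination_treeRelation]
    simp only [Sum.elim_inr, Sum.elim_inl]
    obtain ⟨m, t, i⟩ := τ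
    -- On a branch through the node sequence of `τ`, the defect of the Bass relation cancels the
    -- node term; on other branches every term is zero.
    by_cases h : (fun i : Fin m => ν i) = t
    · subst h
      simp only [if_true, op_bassCoef_relation]
      have := branchNode_eq_iff ν ν i j
      simp only [true_and] at this
      rw [← if_congr this rfl rfl]
      exact sub_self _
    · have hne : branchNode ν n j ≠ ⟨m, (t, i)⟩ := fun h' => h <| by
        obtain rfl : n = m := congrArg Sigma.fst h'
        exact congrArg Prod.fst (eq_of_heq (Sigma.mk.inj h').2)
      simp [h, hne]

/-- The generator of the tree module at a node. -/
noncomputable def treeNodeGen (τ : TreeNode k Λ) : TreeModule a Λ :=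
  PresentedModule.gen _ (Sum.inl τ)

/-- The generators of the tree module on the branch `ν`. -/
noncomputable def treeBranchGen (ν : ℕ → Λ) (n : ℕ) (j : Fin (k n)) : TreeModule a Λ :=
  PresentedModule.gen _ (Sum.inr (ν, ⟨⟨n, j⟩⟩))

theorem treeBranchGen_eq (ν : ℕ → Λ) (n : ℕ) (j : Fin (k n)) :
    treeBranchGen a ν n j = ∑ l, MulOpposite.op (a n l j) • treeBranchGen a ν (n + 1) l +
      treeNodeGen a (branchNode ν n j) := by
  have := PresentedModule.linearCombination_gen_relation (ρ := treeRelation (Λ := Λ) a)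
    (ν, ⟨⟨n, j⟩⟩)
  rw [linearCombination_treeRelation, sub_sub, sub_eq_zero] at this
  exact this

open Classical in
theorem treeCoord_treeNodeGen (τ x : TreeNode k Λ) :
    treeCoord a τ (treeNodeGen a x) = if x = τ then 1 else 0 :=
  PresentedModule.lift_gen _ _ _

open Classical in
theorem treeCoord_treeBranchGen (ν ν' : ℕ → Λ) (n : ℕ) (i j : Fin (k n)) :
    treeCoord a (branchNode ν n i) (treeBranchGen a ν' n j) =
      if (fun t : Fin n => ν' t) = (fun t : Fin n => ν t) then if i = j then 1 else 0 else 0 := by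
  refine (PresentedModule.lift_gen _ _ _).trans ?_
  change (if (fun t : Fin n => ν' t) = (fun t : Fin n => ν t) then
    MulOpposite.op (bassCoef a ⟨n, j⟩ n i) else 0) = _
  rw [bassCoef_self]
  split_ifs <;> rfl

variable {X : Type u} [AddCommGroup X] [Module R X]

/-- The elements of `L ⊗ X` supported on nodes. -/
noncomputable def nodeSum : (TreeNode k Λ →₀ X) →+ BalancedTensor R (TreeModule a Λ) X :=
  Finsupp.liftAddHom fun τ => (show X →+ _ from mk (TreeModule a Λ) X (treeNodeGen a τ))

theorem nodeSum_single (τ : TreeNode k Λ) (x : X) :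
    nodeSum a (Finsupp.single τ x) = tmul R (treeNodeGen a τ) x :=
  Finsupp.liftAddHom_apply_single _ _ _

theorem eval_treeCoord_nodeSum (τ : TreeNode k Λ) (x : TreeNode k Λ →₀ X) :
    eval X (treeCoord a τ) (nodeSum a x) = x τ := by
  classical
  have : (eval X (treeCoord a τ)).comp (nodeSum a) = Finsupp.applyAddHom τ := by
    ext σ y
    simp only [AddMonoidHom.comp_apply, Finsupp.singleAddHom_apply, nodeSum_single, eval_tmul,
      treeCoord_treeNodeGen, Finsupp.applyAddHom_apply, Finsupp.single_apply]
    split_ifs <;> simp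
  exact DFunLike.congr_fun this x

/-- `z` is a sum of an element supported on nodes of level less than `n` and of tensors of
generators of level `n` on branches in `E`. -/
def TreeRepresented (n : ℕ) (E : Finset (ℕ → Λ)) (z : BalancedTensor R (TreeModule a Λ) X) : Prop :=
  ∃ (x : TreeNode k Λ →₀ X) (y : (ℕ → Λ) → Fin (k n) → X), (∀ τ, n ≤ τ.1 → x τ = 0) ∧
    z = nodeSum a x + ∑ ν ∈ E, ∑ j, tmul R (treeBranchGen a ν n j) (y ν j)

variable {a}

theorem TreeRepresented.add {n : ℕ} {E : Finset (ℕ → Λ)}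
    {z z' : BalancedTensor R (TreeModule a Λ) X} (h : TreeRepresented a n E z)
    (h' : TreeRepresented a n E z') : TreeRepresented a n E (z + z') := by
  obtain ⟨x, y, hx, rfl⟩ := h
  obtain ⟨x', y', hx', rfl⟩ := h'
  refine ⟨x + x', y + y', fun τ hτ => by rw [Finsupp.add_apply, hx τ hτ, hx' τ hτ, add_zero], ?_⟩
  simp only [map_add, Pi.add_apply, tmul_add, Finset.sum_add_distrib]
  abel

theorem TreeRepresented.mono {n : ℕ} {E E' : Finset (ℕ → Λ)} (hE : E ⊆ E')
    {z : BalancedTensor R (TreeModule a Λ) X} (h : TreeRepresented a n E z) :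
    TreeRepresented a n E' z := by
  classical
  obtain ⟨x, y, hx, rfl⟩ := h
  refine ⟨x, fun ν => if ν ∈ E then y ν else 0, hx, ?_⟩
  rw [← Finset.sum_subset hE]
  · congr 1
    exact Finset.sum_congr rfl fun ν hν => by simp [hν]
  · intro ν _ hν
    simp [hν]

/-- The relations replace a branch generator of level `n` by generators of level `n + 1` and one
node of level `n`. -/
theorem TreeRepresented.succ {n : ℕ} {E : Finset (ℕ → Λ)}
    {z : BalancedTensor R (TreeModule a Λ) X} (h : TreeRepresented a n E z) :
    TreeRepresented a (n + 1) E z := by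
  obtain ⟨x, y, hx, rfl⟩ := h
  refine ⟨x + ∑ ν ∈ E, ∑ j, Finsupp.single (branchNode ν n j) (y ν j),
    fun ν l => ∑ j, a n l j • y ν j, fun τ hτ => ?_, ?_⟩
  · rw [Finsupp.add_apply, hx τ (by omega), zero_add, Finsupp.finsetSum_apply]
    refine Finset.sum_eq_zero fun ν _ => ?_
    rw [Finsupp.finsetSum_apply]
    refine Finset.sum_eq_zero fun j _ => Finsupp.single_eq_of_ne ?_
    rintro rfl
    exact absurd hτ (Nat.not_succ_le_self n)
  · simp only [map_add, map_sum, nodeSum_single, add_assoc, ← Finset.sum_add_distrib]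
    congr 1
    refine Finset.sum_congr rfl fun ν _ => ?_
    simp only [tmul_sum]
    rw [Finset.sum_comm, add_comm, ← Finset.sum_add_distrib]
    refine Finset.sum_congr rfl fun j _ => ?_
    rw [treeBranchGen_eq, add_tmul, sum_tmul]
    simp only [smul_tmul]

theorem TreeRepresented.of_le {n m : ℕ} (hnm : n ≤ m) {E : Finset (ℕ → Λ)}
    {z : BalancedTensor R (TreeModule a Λ) X} (h : TreeRepresented a n E z) :
    TreeRepresented a m E z := by
  induction m, hnm using Nat.le_induction with
  | base => exact h
  | succ m _ ih => exact ih.succ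

theorem exists_treeRepresented (z : BalancedTensor R (TreeModule a Λ) X) :
    ∃ n E, TreeRepresented a n E z := by
  classical
  have hadd : ∀ z z' : BalancedTensor R (TreeModule a Λ) X, (∃ n E, TreeRepresented a n E z) →
      (∃ n E, TreeRepresented a n E z') → ∃ n E, TreeRepresented a n E (z + z') := by
    rintro z z' ⟨n, E, h⟩ ⟨n', E', h'⟩
    exact ⟨max n n', E ∪ E', ((h.mono Finset.subset_union_left).of_le (le_max_left _ _)).add
      ((h'.mono Finset.subset_union_right).of_le (le_max_right _ _))⟩
  have hzero : ∃ n E, TreeRepresented a n E (0 : BalancedTensor R (TreeModule a Λ) X) :=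
    ⟨0, ∅, 0, 0, fun _ _ => rfl, by simp⟩
  induction z using induction_on with
  | zero => exact hzero
  | add z z' h h' => exact hadd z z' h h'
  | tmul m x =>
    obtain ⟨c, rfl⟩ := Submodule.Quotient.mk_surjective _ m
    rw [← PresentedModule.linearCombination_gen, Finsupp.linearCombination_apply, Finsupp.sum,
      sum_tmul]
    refine Finset.sum_induction _ _ hadd hzero fun i _ => ?_
    rw [← MulOpposite.op_unop (c i), smul_tmul]
    generalize (c i).unop • x = x
    obtain τ | ⟨ν, ⟨⟨n, j⟩⟩⟩ := i
    · refine ⟨τ.1 + 1, ∅, Finsupp.single τ x, 0, fun σ hσ => Finsupp.single_eq_of_ne ?_, ?_⟩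
      · rintro rfl
        exact absurd hσ (Nat.not_succ_le_self _)
      · rw [nodeSum_single, Finset.sum_empty, add_zero]
        rfl
    · refine ⟨n, {ν}, 0, fun _ => Pi.single j x, fun _ _ => rfl, ?_⟩
      rw [map_zero, zero_add, Finset.sum_singleton, Finset.sum_eq_single j]
      · simp only [Pi.single_eq_same]
        rfl
      · intro i _ hi
        simp only [Pi.single_eq_of_ne hi, tmul_zero]
      · simp

theorem exists_restrict_injOn (E : Finset (ℕ → Λ)) : ∃ N : ℕ, ∀ n, N ≤ n → ∀ ν ∈ E, ∀ ν' ∈ E,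
    (fun t : Fin n => ν' t) = (fun t : Fin n => ν t) → ν' = ν := by
  have : ∀ᶠ n in Filter.atTop, ∀ p ∈ E ×ˢ E,
      (fun t : Fin n => p.2 t) = (fun t : Fin n => p.1 t) → p.2 = p.1 := by
    rw [Filter.eventually_all_finset]
    intro p _
    by_cases hp : p.2 = p.1
    · exact Filter.Eventually.of_forall fun _ _ => hp
    · obtain ⟨m, hm⟩ := Function.ne_iff.1 hp
      filter_upwards [Filter.eventually_gt_atTop m] with n hn h
      exact absurd (congrFun h ⟨m, hn⟩) hm
  obtain ⟨N, hN⟩ := Filter.eventually_atTop.1 this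
  exact ⟨N, fun n hn ν hν ν' hν' => hN n hn (ν, ν') (Finset.mk_mem_product hν hν')⟩

variable (a)

/-- Represent a tensor at a level where its finitely many branches have separated and above all
nodes involved. Coordinates at that level read off the branch coefficients one by one; once these
vanish, the remaining coordinates read off the node part. -/
theorem pureJointlyInjective_treeCoord :
    PureJointlyInjective (R := R) (treeCoord (Λ := Λ) a) := by
  classical
  refine .of_eval _ fun X z hz => ?_
  obtain ⟨n, E, h⟩ := exists_treeRepresented z
  obtain ⟨N, hN⟩ := exists_restrict_injOn E
  obtain ⟨x, y, hx, hxy⟩ := h.of_le (le_max_left n N)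
  have hy : ∀ ν ∈ E, ∀ i, y ν i = 0 := by
    intro ν hν i
    have := hz (branchNode ν _ i)
    rw [hxy, map_add, eval_treeCoord_nodeSum, hx _ le_rfl, zero_add, map_sum,
      Finset.sum_eq_single_of_mem ν hν, map_sum, Finset.sum_eq_single_of_mem i (Finset.mem_univ _),
      eval_tmul, treeCoord_treeBranchGen, if_pos rfl, if_pos rfl] at this
    · simpa using this
    · intro j _ hj
      rw [eval_tmul, treeCoord_treeBranchGen, if_pos rfl, if_neg hj.symm, MulOpposite.unop_zero,
        zero_smul]
    · intro ν' hν' hne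
      rw [map_sum]
      refine Finset.sum_eq_zero fun j _ => ?_
      rw [eval_tmul, treeCoord_treeBranchGen,
        if_neg fun h => hne (hN _ (le_max_right _ _) ν hν ν' hν' h), MulOpposite.unop_zero,
        zero_smul]
  have hz' : z = nodeSum a x := by
    rw [hxy, Finset.sum_eq_zero fun ν hν => Finset.sum_eq_zero fun j _ => ?_, add_zero]
    rw [hy ν hν, tmul_zero]
  have hx' : x = 0 := by
    ext τ
    rw [← eval_treeCoord_nodeSum a τ x, ← hz']
    exact hz τ
  rw [hz', hx', map_zero]

theorem flatMittagLeffler_treeModule (𝒬 : ObjectProperty (ModuleCat.{u} R)) (Λ : Type u) :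
    flatMittagLefflerModules 𝒬 (ModuleCat.of Rᵐᵒᵖ (TreeModule a Λ)) :=
  (pureJointlyInjective_treeCoord a).flatMittagLeffler fun _ => flatMittagLeffler_ring

end Tree

/-! ### Cardinal arithmetic and the counting argument. -/

/-- The iterated power sets of a type. -/
def IteratedSet (B : Type u) : ℕ → Type u
  | 0 => B
  | n + 1 => Set (IteratedSet B n)

/-- The union `Λ` of the iterated power sets works: a subset of `Λ` is determined by its traces on
the levels, and its trace on level `n` is an element of level `n + 1`. -/
theorem exists_two_power_le_nat_fun (B : Type u) :
    ∃ Λ : Type u, ℵ₀ ≤ #Λ ∧ #B ≤ #Λ ∧ 2 ^ #Λ ≤ #(ℕ → Λ) := by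
  let T := IteratedSet (B ⊕ ULift.{u} ℕ)
  have h0 : #(B ⊕ ULift.{u} ℕ) ≤ #(Σ n, T n) :=
    mk_le_of_injective (f := fun x => (⟨0, x⟩ : Σ n, T n)) fun x y h => eq_of_heq (Sigma.mk.inj h).2
  refine ⟨Σ n, T n, ?_, ?_, ?_⟩
  · refine le_trans ?_ h0
    simp
  · refine le_trans ?_ h0
    simp
  · rw [← mk_set]
    refine mk_le_of_injective (f := fun (s : Set (Σ n, T n)) (n : ℕ) =>
      (⟨n + 1, {x : T n | (⟨n, x⟩ : Σ n, T n) ∈ s}⟩ : Σ n, T n)) fun s s' h => ?_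
    ext ⟨n, x⟩
    have h1 : {x : T n | (⟨n, x⟩ : Σ n, T n) ∈ s} = {x : T n | (⟨n, x⟩ : Σ n, T n) ∈ s'} :=
      eq_of_heq (Sigma.mk.inj (congrFun h n)).2
    exact Set.ext_iff.1 h1 x

theorem mk_treeNode_le (k : ℕ → ℕ) {Λ : Type u} (hΛ : ℵ₀ ≤ #Λ) : #(TreeNode k Λ) ≤ #Λ := by
  refine mk_sigma_nat_le hΛ fun m => ?_
  simp only [mk_prod]
  refine mul_le_of_le hΛ ?_ ?_
  · rw [lift_id']
    exact mk_fin_fun_le hΛ le_rfl m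
  · simpa using (natCast_lt_aleph0.le).trans hΛ

theorem flatMittagLefflerModules_eq_of_extLeftPerp_eq {R : Type u} [Ring R]
    {𝒬 : ObjectProperty (ModuleCat.{u} R)} {𝒞 : ObjectProperty (ModuleCat.{u} Rᵐᵒᵖ)}
    (h𝒞 : extLeftPerp 𝒞 = flatMittagLefflerModules 𝒬) :
    flatMittagLefflerModules 𝒬 = flatModules R := by
  classical
  refine le_antisymm (fun M hM => hM.1) fun M hM => ⟨hM, ?_⟩
  by_contra hM'
  obtain ⟨k, a, P, q, hP, hq, hq', hq0⟩ := exists_bass_sequence hM hM'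
  have hN : ¬ extLeftPerp 𝒞 (ModuleCat.of Rᵐᵒᵖ (PresentedModule (bassRelation.{u} a))) := by
    rw [h𝒞]
    exact fun h => bassModule_not_mittagLeffler a hP hq hq' hq0 h.2
  simp only [extLeftPerp, not_forall] at hN
  obtain ⟨B, hB, hNB⟩ := hN
  obtain ⟨b, hb⟩ := not_forall.1 (mt PresentedModule.subsingleton_ext hNB)
  obtain ⟨Λ, hΛ, hBΛ, hpow⟩ := exists_two_power_le_nat_fun B
  have hL : extLeftPerp 𝒞 (ModuleCat.of Rᵐᵒᵖ (TreeModule a Λ)) := by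
    rw [h𝒞]
    exact flatMittagLeffler_treeModule a 𝒬 Λ
  -- For each set `S` of branches, the unsolvable right-hand side `b` is placed on the branches in
  -- `S` and zero on the others.
  have key := fun S : Set (ℕ → Λ) => PresentedModule.exists_of_subsingleton_ext
    (linearIndependent_treeRelation a) (hL B hB) fun t => if t.1 ∈ S then b t.2 else 0
  choose c hc using key
  have hinj : Function.Injective fun (S : Set (ℕ → Λ)) (τ : TreeNode k Λ) => c S (Sum.inl τ) := by
    have hsub : ∀ S S' : Set (ℕ → Λ),
        (fun τ => c S (Sum.inl τ)) = (fun τ => c S' (Sum.inl τ)) → S ⊆ S' := by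
      intro S S' h ν hν
      by_contra hν'
      -- If two solutions agree on nodes, the node terms cancel in their difference along a branch
      -- in `S` but not in `S'`, which would solve the Bass system for `b`.
      refine hb ⟨fun s => c S (Sum.inr (ν, s)) - c S' (Sum.inr (ν, s)), ?_⟩
      rintro ⟨⟨n, j⟩⟩
      have h1 := hc S (ν, ⟨⟨n, j⟩⟩)
      have h2 := hc S' (ν, ⟨⟨n, j⟩⟩)
      rw [linearCombination_treeRelation, if_pos hν] at h1
      rw [linearCombination_treeRelation, if_neg hν', ← congrFun h] at h2
      rw [linearCombination_bassRelation]
      refine Eq.trans ?_ ((congrArg₂ (· - ·) h1 h2).trans (sub_zero _))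
      simp only [smul_sub, Finset.sum_sub_distrib]
      abel
    exact fun S S' h => (hsub S S' h).antisymm (hsub S' S h.symm)
  have hle : (2 : Cardinal.{u}) ^ (2 : Cardinal.{u}) ^ #Λ ≤ 2 ^ #Λ := calc
    (2 : Cardinal.{u}) ^ (2 : Cardinal.{u}) ^ #Λ ≤ 2 ^ #(ℕ → Λ) :=
      power_le_power_left two_ne_zero hpow
    _ = #(Set (ℕ → Λ)) := (mk_set).symm
    _ ≤ #(TreeNode k Λ → B) := mk_le_of_injective hinj
    _ = #B ^ #(TreeNode k Λ) := by simp
    _ ≤ #Λ ^ #Λ := (power_le_power_right hBΛ).trans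
      (power_le_power_left (aleph0_pos.trans_le hΛ).ne' (mk_treeNode_le k hΛ))
    _ = 2 ^ #Λ := power_self_eq hΛ
  exact (cantor _).not_ge hle

theorem mainTheorem4 (R : Type u) [Ring R] (𝒬 : ObjectProperty (ModuleCat.{u} R)) :
    (∀ κ : Cardinal.{u},
      extLeftPerp (extRightPerp (ltPresentedIn (flatMittagLefflerModules 𝒬) κ)) ≤
        flatMittagLefflerModules 𝒬) ∧
    ((∃ κ : Cardinal.{u},
      extLeftPerp (extRightPerp (ltPresentedIn (flatMittagLefflerModules 𝒬) κ)) =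
        flatMittagLefflerModules 𝒬) ↔
      flatMittagLefflerModules 𝒬 = flatModules R) := by
  refine ⟨extLeftPerp_extRightPerp_le,
    fun ⟨κ, hκ⟩ => flatMittagLefflerModules_eq_of_extLeftPerp_eq hκ,
    fun h => ⟨Order.succ (max #Rᵐᵒᵖ ℵ₀), le_antisymm (extLeftPerp_extRightPerp_le _) ?_⟩⟩
  rw [h]
  exact flatModules_le_extLeftPerp
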